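/- Let $n\in\mathbb{N}$, $\alpha>0$, $\beta>1$, and let $w,v$ be weights on $\mathbb{R}^n$ ($w>0$ and $v\ge 0$ a.e.) such that $w,\ w^{-\alpha},\ v^{\beta}\in L^1_{\mathrm{loc}}(\mathbb{R}^n)$. Assume that $$\max\Bigl\{n\Bigl(\frac1\alpha+\frac1\beta\Bigr),\,1+\frac1\alpha\Bigr\}\le p<n\Bigl(1+\frac1\alpha\Bigr),$$ and let $d\mu=w\,dx$ and $d\nu=v\,dx$. With $\nabla u$ denoting the distributional gradient of $u\in L^1_{\mathrm{loc}}(\mathbb{R}^n,dx)$, let $$W^{1,p}(\mathbb{R}^n,\mu)=\{u\in L^p(\mathbb{R}^n,\mu):|\nabla u|\in L^p(\mathbb{R}^n,\mu)\},\qquad D^{p}(\mathbb{R}^n,\mu)=\{u\in L^1_{\mathrm{loc}}(\mathbb{R}^n,\mu):|\nabla u|\in L^p(\mathbb{R}^n,\mu)\}.$$ Let $E\subset\mathbb{R}^n$ be a bounded Lebesgue measurable set. Equip $W^{1,p}(\mathbb{R}^n,\mu)$ with the norm $\|u\|_{L^p(\mathbb{R}^n,\mu)}+\|\nabla u\|_{L^p(\mathbb{R}^n,\mu)}$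 and $D^p(\mathbb{R}^n,\mu)\cap L^1(E,\nu)$ with $\|\nabla u\|_{L^p(\mathbb{R}^n,\mu)}+\|u\|_{L^1(E,\nu)}$. Then, for every exponent $$1\le q\le\frac{np\,(1-1/\beta)}{(n-p)+n/\alpha}$$ (the limiting exponent included), the restriction maps $u\mapsto u|_E$, $$W^{1,p}(\mathbb{R}^n,\mu)\longrightarrow L^q(E,\nu)\qquad\text{and}\qquad D^p(\mathbb{R}^n,\mu)\cap L^1(E,\nu)\longrightarrow L^q(E,\nu),$$ are well defined and compact, i.e. every bounded sequence has a subsequence whose restrictions to $E$ converge in $L^q(E,\nu)$. -/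

import Mathlib

open MeasureTheory Filter Topology
open scoped ENNReal NNReal ContDiff

noncomputable section

namespace WeightedSobolev

/-- The weighted measure `w dx` on `ℝⁿ`. -/
def weightedMeasure {n : ℕ} (w : EuclideanSpace ℝ (Fin n) → ℝ) :
    Measure (EuclideanSpace ℝ (Fin n)) :=
  volume.withDensity fun x => ENNReal.ofReal (w x)

/-- The vector field `g` is the distributional gradient of `u` on `ℝⁿ`: both are locally integrable
with respect to Lebesgue measure and `∫ u ∂ᵢφ dx = -∫ gᵢ φ dx` for every test function
`φ ∈ C_c^∞(ℝⁿ)` and every `i`. -/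
def HasWeakGradient {n : ℕ} (u : EuclideanSpace ℝ (Fin n) → ℝ)
    (g : EuclideanSpace ℝ (Fin n) → EuclideanSpace ℝ (Fin n)) : Prop :=
  LocallyIntegrable u volume ∧ LocallyIntegrable g volume ∧
    ∀ φ : EuclideanSpace ℝ (Fin n) → ℝ, ContDiff ℝ ∞ φ → HasCompactSupport φ →
      ∀ i : Fin n,
        ∫ x, u x * fderiv ℝ φ x (EuclideanSpace.single i 1) = -∫ x, g x i * φ x

/-- Distributional gradients are unique almost everywhere. -/
theorem HasWeakGradient.ae_eq {n : ℕ} {u : EuclideanSpace ℝ (Fin n) → ℝ}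
    {g h : EuclideanSpace ℝ (Fin n) → EuclideanSpace ℝ (Fin n)}
    (hg : HasWeakGradient u g) (hh : HasWeakGradient u h) : g =ᵐ[volume] h := by
  have key : ∀ i : Fin n, ∀ᵐ x, g x i = h x i := by
    intro i
    have hloc : ∀ f : EuclideanSpace ℝ (Fin n) → EuclideanSpace ℝ (Fin n),
        LocallyIntegrable f volume → LocallyIntegrable (fun x => f x i) volume := by
      intro f hf x
      obtain ⟨s, hs, hfs⟩ := hf x
      exact ⟨s, hs, (EuclideanSpace.proj (𝕜 := ℝ) i).integrable_comp hfs⟩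
    refine ae_eq_of_integral_contDiff_smul_eq (hloc g hg.2.1) (hloc h hh.2.1) ?_
    intro φ hφ hc
    have h1 := hg.2.2 φ hφ hc i
    have h2 := hh.2.2 φ hφ hc i
    simp only [smul_eq_mul, mul_comm (φ _)]
    linarith
  filter_upwards [ae_all_iff.2 key] with x hx
  ext i
  exact hx i

open Classical in
/-- The distributional gradient `∇u`, as a function (`0` if `∇u` is not a locally integrable
function). -/
def weakGradient {n : ℕ} (u : EuclideanSpace ℝ (Fin n) → ℝ) :
    EuclideanSpace ℝ (Fin n) → EuclideanSpace ℝ (Fin n) :=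
  if h : ∃ g, HasWeakGradient u g then h.choose else 0

/-- `W^{1,p}(ℝⁿ, μ) = {u ∈ L^p(ℝⁿ, μ) : |∇u| ∈ L^p(ℝⁿ, μ)}`. -/
def sobolevSpace {n : ℕ} (p : ℝ) (μ : Measure (EuclideanSpace ℝ (Fin n))) :
    Set (EuclideanSpace ℝ (Fin n) → ℝ) :=
  {u | (∃ g, HasWeakGradient u g) ∧ MemLp u (ENNReal.ofReal p) μ ∧
    MemLp (weakGradient u) (ENNReal.ofReal p) μ}

/-- The norm `‖u‖_{L^p(μ)} + ‖∇u‖_{L^p(μ)}` of `W^{1,p}(ℝⁿ, μ)`. -/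
def sobolevNorm {n : ℕ} (p : ℝ) (μ : Measure (EuclideanSpace ℝ (Fin n)))
    (u : EuclideanSpace ℝ (Fin n) → ℝ) : ℝ≥0∞ :=
  eLpNorm u (ENNReal.ofReal p) μ + eLpNorm (weakGradient u) (ENNReal.ofReal p) μ

/-- `D^p(ℝⁿ, μ) = {u ∈ L¹_loc(ℝⁿ, μ) : |∇u| ∈ L^p(ℝⁿ, μ)}`. -/
def dirichletSpace {n : ℕ} (p : ℝ) (μ : Measure (EuclideanSpace ℝ (Fin n))) :
    Set (EuclideanSpace ℝ (Fin n) → ℝ) :=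
  {u | (∃ g, HasWeakGradient u g) ∧ LocallyIntegrable u μ ∧
    MemLp (weakGradient u) (ENNReal.ofReal p) μ}

/-- `L¹(E, ν)`, as a set of functions on `ℝⁿ`. -/
def integrableOnSpace {n : ℕ} (E : Set (EuclideanSpace ℝ (Fin n)))
    (ν : Measure (EuclideanSpace ℝ (Fin n))) : Set (EuclideanSpace ℝ (Fin n) → ℝ) :=
  {u | IntegrableOn u E ν}

/-- The norm `‖∇u‖_{L^p(μ)} + ‖u‖_{L¹(E, ν)}` of `D^p(ℝⁿ, μ) ∩ L¹(E, ν)`. -/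
def dirichletNorm {n : ℕ} (p : ℝ) (μ : Measure (EuclideanSpace ℝ (Fin n)))
    (E : Set (EuclideanSpace ℝ (Fin n))) (ν : Measure (EuclideanSpace ℝ (Fin n)))
    (u : EuclideanSpace ℝ (Fin n) → ℝ) : ℝ≥0∞ :=
  eLpNorm (weakGradient u) (ENNReal.ofReal p) μ + eLpNorm u 1 (ν.restrict E)

/-- Let `Y` be a set of functions, identified when they agree `μ`-a.e., with norm `N`. The map
`Y → L^q(E, ν)`, `u ↦ u|_E`, is well defined and compact: every `u ∈ Y` restricts to an element of
`L^q(E, ν)`, which depends only on the `μ`-a.e. class of `u`, and every sequence in `Y` which is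
bounded with respect to `N` has a subsequence which converges in `L^q(E, ν)`. -/
def IsCompactEmbedding {n : ℕ} (μ : Measure (EuclideanSpace ℝ (Fin n)))
    (Y : Set (EuclideanSpace ℝ (Fin n) → ℝ)) (N : (EuclideanSpace ℝ (Fin n) → ℝ) → ℝ≥0∞)
    (q : ℝ) (E : Set (EuclideanSpace ℝ (Fin n))) (ν : Measure (EuclideanSpace ℝ (Fin n))) : Prop :=
  (∀ u ∈ Y, MemLp u (ENNReal.ofReal q) (ν.restrict E)) ∧
  (∀ u ∈ Y, ∀ u' ∈ Y, u =ᵐ[μ] u' → u =ᵐ[ν.restrict E] u') ∧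
  ∀ u : ℕ → EuclideanSpace ℝ (Fin n) → ℝ, (∀ k, u k ∈ Y) → (∃ M : ℝ≥0, ∀ k, N (u k) ≤ M) →
    ∃ f : EuclideanSpace ℝ (Fin n) → ℝ, MemLp f (ENNReal.ofReal q) (ν.restrict E) ∧
      ∃ σ : ℕ → ℕ, StrictMono σ ∧
        Tendsto (fun k => eLpNorm (u (σ k) - f) (ENNReal.ofReal q) (ν.restrict E)) atTop (𝓝 0)

end WeightedSobolev

end

open MeasureTheory Filter Topology
open scoped ENNReal NNReal ContDiff

noncomputable section

set_option linter.unusedSectionVars false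

namespace WeightedSobolev

open scoped Convolution BoundedContinuousFunction
open ContinuousLinearMap (lsmul)

/-! Two applications of Hölder's inequality reduce the weighted statement to unweighted Sobolev
theory. Local integrability of `w^(-α)` puts `L^p(w dx)` locally inside `L^s(dx)` with `s =
αp/(α+1)`. The condition `p ≥ 1 + 1/α` says `s ≥ 1`, and `p < n(1 + 1/α)` says `s < n`, so gradients
in `L^p(w dx)` give local bounds for `u` in `L^{s'}`, where `1/s' = 1/s - 1/n`. Local integrability
of `v^β` then embeds `L^{s'}` on a ball into `L^q(E, v dx)` as soon as `qβ/(β-1) ≤ s'`, which is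
exactly the assumed bound on `q`.

Compactness survives at the limiting exponent, although the embedding into `L^{s'}` itself is in
general not compact. Rellich–Kondrachov in `L¹` (`exists_strictMono_ae_tendsto`) gives a subsequence
converging almost everywhere. The functions `v^{1/q} u_k` are uniformly integrable in `L^q`, because
the fixed function `v^{1/q}` lies in `L^{qβ}(E)` and has small norm on small sets, while the `u_k`
are merely bounded in `L^{s'}`. Vitali's theorem concludes
(`tendsto_eLpNorm_weighted_of_ae_tendsto`).

For the Sobolev space the `L^{s'}` bound is `exists_sobolev`. For the Dirichlet space
Poincaré–Sobolev bounds only `u - c`; the constant `c` is recovered from the `L¹(E, ν)` norm in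
`exists_sobolev_of_measure`, unless `ν(E) = 0`, when nothing is to be proved. Both cases feed
`isCompactEmbedding_of_bounds`. The unweighted results are derived from `C¹` estimates by
mollification. -/

theorem aemeasurable_section {X Z : Type*} [MeasurableSpace X] [MeasurableSpace Z]
    {μ : Measure X} {m : Measure Z} [SFinite m] {h : X → Z → ℝ≥0∞}
    (hh : AEMeasurable (Function.uncurry h) (μ.prod m)) :
    ∀ᵐ x ∂μ, AEMeasurable (h x) m := by
  filter_upwards [Measure.ae_ae_of_ae_prod hh.ae_eq_mk] with x hx
  exact ⟨fun z => hh.mk _ (x, z), hh.measurable_mk.comp measurable_prodMk_left, hx⟩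

/-- Jensen's inequality combined with Tonelli's theorem. -/
theorem lintegral_rpow_le_of_le_lintegral {X Z : Type*} [MeasurableSpace X] [MeasurableSpace Z]
    {μ : Measure X} [SFinite μ] {m : Measure Z} [IsProbabilityMeasure m] {N : X → ℝ≥0∞}
    {h : X → Z → ℝ≥0∞} {s : ℝ} (hs : 1 ≤ s) {C : ℝ≥0∞}
    (hh : AEMeasurable (Function.uncurry h) (μ.prod m))
    (hN : ∀ᵐ x ∂μ, N x ≤ ∫⁻ z, h x z ∂m) (hC : ∀ᵐ z ∂m, ∫⁻ x, h x z ^ s ∂μ ≤ C) :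
    ∫⁻ x, N x ^ s ∂μ ≤ C := by
  have hs0 : 0 < s := by linarith
  calc ∫⁻ x, N x ^ s ∂μ ≤ ∫⁻ x, ∫⁻ z, h x z ^ s ∂m ∂μ := by
        refine lintegral_mono_ae ?_
        filter_upwards [hN, aemeasurable_section hh] with x hx hm
        refine (ENNReal.rpow_le_rpow hx hs0.le).trans ?_
        have := eLpNorm'_le_eLpNorm'_of_exponent_le (μ := m) (f := h x) (p := 1) (q := s)
          one_pos hs hm.aestronglyMeasurable
        simp only [eLpNorm', enorm_eq_self, ENNReal.rpow_one, div_one] at this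
        refine (ENNReal.rpow_le_rpow this hs0.le).trans ?_
        rw [← ENNReal.rpow_mul, one_div, inv_mul_cancel₀ hs0.ne', ENNReal.rpow_one]
    _ = ∫⁻ z, ∫⁻ x, h x z ^ s ∂μ ∂m := lintegral_lintegral_swap (hh.pow_const s)
    _ ≤ ∫⁻ _, C ∂m := lintegral_mono_ae hC
    _ = C := by simp

/-! ### Mollification as an average over a probability measure -/

section Mollify
variable {V : Type*} [NormedAddCommGroup V] [NormedSpace ℝ V] [FiniteDimensional ℝ V]
  [MeasureSpace V] [BorelSpace V] [(volume : Measure V).IsAddHaarMeasure]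
  {F : Type*} [NormedAddCommGroup F] [NormedSpace ℝ F]

/-- The probability measure whose density is the normed bump function `φ`. -/
def bumpMeasure (φ : ContDiffBump (0 : V)) : Measure V :=
  volume.withDensity fun z => ENNReal.ofReal (φ.normed volume z)

/-- The mollification of `u` by the normed bump function `φ`. -/
def mollify (φ : ContDiffBump (0 : V)) (u : V → F) : V → F :=
  φ.normed volume ⋆[lsmul ℝ ℝ, volume] u

theorem lintegral_bumpMeasure (φ : ContDiffBump (0 : V)) {f : V → ℝ≥0∞} (hf : AEMeasurable f) :
    ∫⁻ z, f z ∂(bumpMeasure φ) = ∫⁻ z, ENNReal.ofReal (φ.normed volume z) * f z := by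
  rw [bumpMeasure, lintegral_withDensity_eq_lintegral_mul₀ (by
    exact (φ.continuous_normed.measurable.ennreal_ofReal).aemeasurable) hf]
  rfl

instance (φ : ContDiffBump (0 : V)) : IsProbabilityMeasure (bumpMeasure φ) := by
  constructor
  rw [bumpMeasure, withDensity_apply _ MeasurableSet.univ, Measure.restrict_univ,
    ← ofReal_integral_eq_lintegral_ofReal φ.integrable_normed
      (ae_of_all _ φ.nonneg_normed), φ.integral_normed, ENNReal.ofReal_one]

theorem bumpMeasure_ae_norm_le (φ : ContDiffBump (0 : V)) :
    ∀ᵐ z ∂(bumpMeasure φ), ‖z‖ ≤ φ.rOut := by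
  rw [bumpMeasure, ae_withDensity_iff φ.continuous_normed.measurable.ennreal_ofReal]
  refine ae_of_all _ fun z hz => ?_
  by_contra h
  apply hz
  have : z ∉ Function.support (φ.normed volume) := by
    rw [φ.support_normed_eq]; simp at h ⊢; exact h.le
  simp [Function.notMem_support.1 this]

theorem bumpMeasure_absolutelyContinuous (φ : ContDiffBump (0 : V)) :
    bumpMeasure φ ≪ volume := withDensity_absolutelyContinuous _ _

/-- `u` is measurable only up to null sets, so composing it with subtraction requires that preimages
of null sets be null. -/
theorem aestronglyMeasurable_sub_prod {u : V → F} (hu : AEStronglyMeasurable u volume)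
    {μ m : Measure V} [SFinite μ] [SFinite m] (hμ : μ ≪ volume) (hm : m ≪ volume) :
    AEStronglyMeasurable (fun q : V × V => u (q.1 - q.2)) (μ.prod m) := by
  have := hu.comp_quasiMeasurePreserving
    (quasiMeasurePreserving_sub_of_right_invariant (volume : Measure V) volume)
  exact this.mono_ac (hμ.prod hm)

theorem setLIntegral_comp_sub_ball_le (f : V → ℝ≥0∞) (z : V) (R : ℝ) :
    ∫⁻ x in Metric.ball 0 R, f (x - z) ≤ ∫⁻ x in Metric.ball 0 (R + ‖z‖), f x := by
  rw [← lintegral_indicator Metric.isOpen_ball.measurableSet,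
    ← lintegral_indicator Metric.isOpen_ball.measurableSet,
    ← lintegral_sub_right_eq_self (Set.indicator (Metric.ball 0 (R + ‖z‖)) f) z]
  refine lintegral_mono fun x => ?_
  by_cases hx : x ∈ Metric.ball (0 : V) R
  · have : x - z ∈ Metric.ball (0 : V) (R + ‖z‖) := by
      simp at hx ⊢
      linarith [norm_sub_le x z]
    simp [Set.indicator_of_mem hx, Set.indicator_of_mem this]
  · simp [Set.indicator_of_notMem hx]

/-- The kernel has integral one, so a constant passes under the average. With `c = 0` this bounds
the mollification; with `c = u x` it bounds the approximation error. -/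
theorem enorm_mollify_sub_le [CompleteSpace F] (φ : ContDiffBump (0 : V)) {u : V → F}
    (hu : LocallyIntegrable u volume) (x : V) (c : F) :
    ‖mollify φ u x - c‖ₑ ≤ ∫⁻ z, ‖u (x - z) - c‖ₑ ∂(bumpMeasure φ) := by
  have hm : AEStronglyMeasurable (fun z => u (x - z)) volume :=
    hu.aestronglyMeasurable.comp_quasiMeasurePreserving
      (quasiMeasurePreserving_sub_left_of_right_invariant volume x)
  have hex : ConvolutionExistsAt (φ.normed volume) u x (lsmul ℝ ℝ) volume :=
    (φ.hasCompactSupport_normed.convolutionExists_left _ φ.continuous_normed hu) x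
  have hc : Integrable (fun z => φ.normed volume z • c) volume := φ.integrable_normed.smul_const c
  have : mollify φ u x - c = ∫ z, φ.normed volume z • (u (x - z) - c) := by
    simp_rw [smul_sub]
    rw [integral_sub _ hc, φ.integral_normed_smul]
    · rfl
    · exact hex
  rw [this, lintegral_bumpMeasure φ (f := fun z => ‖u (x - z) - c‖ₑ)
    (hm.sub aestronglyMeasurable_const).enorm]
  refine (enorm_integral_le_lintegral_enorm _).trans (lintegral_mono fun z => ?_)
  rw [enorm_smul, Real.enorm_of_nonneg (φ.nonneg_normed z)]

theorem lintegral_mollify_rpow_le [CompleteSpace F] (φ : ContDiffBump (0 : V)) {u : V → F}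
    (hu : LocallyIntegrable u volume) {s : ℝ} (hs : 1 ≤ s) (R : ℝ) :
    ∫⁻ x in Metric.ball 0 R, ‖mollify φ u x‖ₑ ^ s ≤
      ∫⁻ x in Metric.ball 0 (R + φ.rOut), ‖u x‖ₑ ^ s := by
  refine lintegral_rpow_le_of_le_lintegral (m := bumpMeasure φ) (h := fun x z => ‖u (x - z)‖ₑ) hs
    (aestronglyMeasurable_sub_prod hu.aestronglyMeasurable
      Measure.restrict_le_self.absolutelyContinuous (bumpMeasure_absolutelyContinuous φ)).enorm
    (ae_of_all _ fun x => by simpa using enorm_mollify_sub_le φ hu x 0) ?_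
  filter_upwards [bumpMeasure_ae_norm_le φ] with z hz
  refine (setLIntegral_comp_sub_ball_le (fun x => ‖u x‖ₑ ^ s) z R).trans ?_
  exact lintegral_mono_set (Metric.ball_subset_ball (by linarith))

theorem contDiff_mollify (φ : ContDiffBump (0 : V)) {u : V → ℝ}
    (hu : LocallyIntegrable u volume) : ContDiff ℝ 1 (mollify φ u) :=
  φ.hasCompactSupport_normed.contDiff_convolution_left (n := 1) _ (φ.contDiff_normed (n := 1)) hu

end Mollify

/-! ### Mollification of weak gradients -/

section Euclidean
variable {n : ℕ}
local notation "𝔼" => EuclideanSpace ℝ (Fin n)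

/-- Differentiating the convolution moves the derivative to the kernel, and `t ↦ ρ (x - t)` is
itself a test function, so the definition of the weak gradient moves it to `u`. -/
theorem fderiv_mollify (φ : ContDiffBump (0 : 𝔼)) {u : 𝔼 → ℝ} {g : 𝔼 → 𝔼}
    (h : HasWeakGradient u g) (x y : 𝔼) :
    fderiv ℝ (mollify φ u) x y = inner ℝ (mollify φ g x) y := by
  have key : ∀ i, fderiv ℝ (mollify φ u) x (EuclideanSpace.single i 1) = mollify φ g x i := by
    intro i
    have hρ : ContDiff ℝ ∞ (φ.normed (volume : Measure 𝔼)) := φ.contDiff_normed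
    have hρ1 : ContDiff ℝ 1 (φ.normed (volume : Measure 𝔼)) := φ.contDiff_normed (n := 1)
    have hρc := φ.hasCompactSupport_normed (μ := (volume : Measure 𝔼))
    set ρ := φ.normed (volume : Measure 𝔼)
    have hd := (hρc.hasFDerivAt_convolution_left (lsmul ℝ ℝ) hρ1 h.1 x).fderiv
    change fderiv ℝ (mollify φ u) x = _ at hd
    have hex := ((hρc.fderiv ℝ).convolutionExists_left ((lsmul ℝ ℝ : ℝ →L[ℝ] ℝ →L[ℝ] ℝ).precompL 𝔼)
      (hρ1.continuous_fderiv one_ne_zero) h.1 x).integrable_swap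
    rw [hd, convolution_eq_swap, ContinuousLinearMap.integral_apply hex]
    have hψ : ContDiff ℝ ∞ (fun t => ρ (x - t)) := hρ.comp (contDiff_const.sub contDiff_id)
    have hψc : HasCompactSupport (fun t => ρ (x - t)) :=
      hρc.comp_homeomorph (Homeomorph.subLeft x)
    have hw := h.2.2 _ hψ hψc i
    have hfd : ∀ t, fderiv ℝ (fun t => ρ (x - t)) t = -fderiv ℝ ρ (x - t) := by
      intro t
      have h1 : HasFDerivAt ρ (fderiv ℝ ρ (x - t)) (x - t) :=
        (hρ1.differentiable one_ne_zero _).hasFDerivAt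
      have h2 := h1.comp t ((hasFDerivAt_id t).const_sub x)
      rw [show (fun t => ρ (x - t)) = ρ ∘ (HSub.hSub x) from rfl, h2.fderiv]
      ext; simp
    have e1 : ∫ t, (((lsmul ℝ ℝ : ℝ →L[ℝ] ℝ →L[ℝ] ℝ).precompL 𝔼) (fderiv ℝ ρ (x - t)) (u t))
        (EuclideanSpace.single i 1) =
        -∫ t, u t * fderiv ℝ (fun t => ρ (x - t)) t (EuclideanSpace.single i 1) := by
      rw [← integral_neg]
      congr 1 with t
      rw [hfd]
      simp [ContinuousLinearMap.precompL_apply, mul_comm]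
    have hexg : Integrable (fun t => ρ (x - t) • g t) :=
      (hρc.convolutionExists_left (lsmul ℝ ℝ) hρ1.continuous h.2.1 x).integrable_swap
    have e2 : mollify φ g x i = ∫ t, g t i * ρ (x - t) := by
      rw [mollify, convolution_eq_swap]
      have := (EuclideanSpace.proj (𝕜 := ℝ) i : 𝔼 →L[ℝ] ℝ).integral_comp_comm hexg
      refine this.symm.trans (integral_congr_ae (ae_of_all _ fun t => ?_))
      simp [mul_comm]
    rw [e1, hw, e2, neg_neg]
  have hy : y = ∑ i, y i • EuclideanSpace.single i (1 : ℝ) := by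
    simpa using ((EuclideanSpace.basisFun (Fin n) ℝ).sum_repr y).symm
  conv_lhs => rw [hy]
  simp only [map_sum, map_smul, key, smul_eq_mul]
  simp [PiLp.inner_apply]

theorem enorm_fderiv_mollify_le (φ : ContDiffBump (0 : 𝔼)) {u : 𝔼 → ℝ} {g : 𝔼 → 𝔼}
    (h : HasWeakGradient u g) (x : 𝔼) :
    ‖fderiv ℝ (mollify φ u) x‖ₑ ≤ ‖mollify φ g x‖ₑ := by
  rw [enorm_le_iff_norm_le]
  refine ContinuousLinearMap.opNorm_le_bound _ (norm_nonneg _) fun y => ?_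
  rw [fderiv_mollify φ h]
  exact norm_inner_le_norm _ _

end Euclidean

/-! ### Translation estimates for `C¹` functions, and approximate identities -/

section Smooth
variable {V : Type*} [NormedAddCommGroup V] [NormedSpace ℝ V] [FiniteDimensional ℝ V]
  [MeasureSpace V] [BorelSpace V] [(volume : Measure V).IsAddHaarMeasure]

theorem enorm_comp_sub_sub_le {u : V → ℝ} (hu : ContDiff ℝ 1 u) (x z : V) :
    ‖u (x - z) - u x‖ₑ ≤
      ∫⁻ t in Set.Icc (0 : ℝ) 1, ‖fderiv ℝ u (x - t • z)‖ₑ * ‖z‖ₑ := by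
  have hc : Continuous fun t : ℝ => fderiv ℝ u (x - t • z) (-z) :=
    ((hu.continuous_fderiv one_ne_zero).comp (by fun_prop)).clm_apply continuous_const
  have hd : ∀ t : ℝ, HasDerivAt (fun t : ℝ => u (x - t • z)) (fderiv ℝ u (x - t • z) (-z)) t := by
    intro t
    have h1 : HasFDerivAt u (fderiv ℝ u (x - t • z)) (x - t • z) :=
      (hu.differentiable one_ne_zero _).hasFDerivAt
    have h2 : HasDerivAt (fun t : ℝ => x - t • z) (-z) t := by
      simpa using ((hasDerivAt_id t).smul_const z).const_sub x
    exact h1.comp_hasDerivAt t h2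
  have := intervalIntegral.integral_eq_sub_of_hasDerivAt (a := 0) (b := 1) (fun t _ => hd t)
    (hc.intervalIntegrable _ _)
  simp only [one_smul, zero_smul, sub_zero] at this
  rw [← this, intervalIntegral.integral_of_le zero_le_one, ← integral_Icc_eq_integral_Ioc]
  refine (enorm_integral_le_lintegral_enorm _).trans (lintegral_mono fun t => ?_)
  simpa using (fderiv ℝ u (x - t • z)).le_opENorm (-z)

/-- The increment is an average of the derivative over the segment from `x` to `x - z`. Jensen and
Tonelli reduce the claim to a fixed `t`, where the ball is shifted by `t • z`. -/
theorem lintegral_comp_sub_sub_rpow_le_of_contDiff {u : V → ℝ} (hu : ContDiff ℝ 1 u) {s : ℝ}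
    (hs : 1 ≤ s) (R : ℝ) (z : V) :
    ∫⁻ x in Metric.ball 0 R, ‖u (x - z) - u x‖ₑ ^ s ≤
      ‖z‖ₑ ^ s * ∫⁻ x in Metric.ball 0 (R + ‖z‖), ‖fderiv ℝ u x‖ₑ ^ s := by
  have : IsProbabilityMeasure (volume.restrict (Set.Icc (0 : ℝ) 1)) := ⟨by simp⟩
  have hcf := hu.continuous_fderiv one_ne_zero
  refine lintegral_rpow_le_of_le_lintegral (m := volume.restrict (Set.Icc (0 : ℝ) 1))
    (h := fun x t => ‖fderiv ℝ u (x - t • z)‖ₑ * ‖z‖ₑ) hs ?_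
    (ae_of_all _ fun x => enorm_comp_sub_sub_le hu x z) ?_
  · have : Continuous fun q : V × ℝ => fderiv ℝ u (q.1 - q.2 • z) := hcf.comp (by fun_prop)
    exact (this.enorm.measurable.mul_const _).aemeasurable
  · filter_upwards [ae_restrict_mem measurableSet_Icc] with t ht
    simp_rw [ENNReal.mul_rpow_of_nonneg _ _ (zero_le_one.trans hs)]
    rw [lintegral_mul_const' _ _ (by finiteness), mul_comm]
    refine mul_le_mul_right ?_ _
    refine (setLIntegral_comp_sub_ball_le (fun x => ‖fderiv ℝ u x‖ₑ ^ s) (t • z) R).trans ?_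
    refine lintegral_mono_set (Metric.ball_subset_ball ?_)
    rw [norm_smul, Real.norm_of_nonneg ht.1]
    nlinarith [norm_nonneg z, ht.2]

/-- Bump functions at the origin with supports shrinking to a point. -/
def bumpSeq (V : Type*) [NormedAddCommGroup V] [NormedSpace ℝ V] (k : ℕ) :
    ContDiffBump (0 : V) :=
  ⟨1 / (2 * ((k : ℝ) + 1)), 1 / ((k : ℝ) + 1), by positivity, by
    apply one_div_lt_one_div_of_lt <;> linarith [(Nat.cast_nonneg k : (0 : ℝ) ≤ k)]⟩

theorem bumpSeq_rOut_le (k : ℕ) : (bumpSeq V k).rOut ≤ 1 := by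
  simp only [bumpSeq]
  rw [div_le_one (by positivity)]
  linarith [(Nat.cast_nonneg k : (0 : ℝ) ≤ k)]

theorem tendsto_bumpSeq_rOut : Tendsto (fun k => (bumpSeq V k).rOut) atTop (𝓝 0) :=
  tendsto_one_div_add_atTop_nhds_zero_nat

/-- Lebesgue differentiation: the ratio of outer to inner radius is always `2`, so the kernels are
dominated by a fixed multiple of ball averages. -/
theorem ae_tendsto_mollify {F : Type*} [NormedAddCommGroup F] [NormedSpace ℝ F] [CompleteSpace F]
    {u : V → F} (hu : LocallyIntegrable u volume) :
    ∀ᵐ x, Tendsto (fun k => mollify (bumpSeq V k) u x) atTop (𝓝 (u x)) := by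
  refine ContDiffBump.ae_convolution_tendsto_right_of_locallyIntegrable (K := 2)
    tendsto_bumpSeq_rOut (Eventually.of_forall fun k => le_of_eq ?_) hu
  simp only [bumpSeq]
  field_simp

end Smooth

/-- Fatou's lemma; this is how bounds for mollifications pass to the original function. -/
theorem lintegral_enorm_rpow_le_of_ae_tendsto {X F : Type*} [MeasurableSpace X] {μ : Measure X}
    [NormedAddCommGroup F] {f : ℕ → X → F} {f₀ : X → F} {s : ℝ} {C : ℝ≥0∞}
    (hf : ∀ k, AEStronglyMeasurable (f k) μ)
    (hlim : ∀ᵐ x ∂μ, Tendsto (fun k => f k x) atTop (𝓝 (f₀ x)))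
    (hC : ∀ k, ∫⁻ x, ‖f k x‖ₑ ^ s ∂μ ≤ C) : ∫⁻ x, ‖f₀ x‖ₑ ^ s ∂μ ≤ C := by
  calc ∫⁻ x, ‖f₀ x‖ₑ ^ s ∂μ ≤ ∫⁻ x, liminf (fun k => ‖f k x‖ₑ ^ s) atTop ∂μ := by
        refine lintegral_mono_ae ?_
        filter_upwards [hlim] with x hx
        have : Tendsto (fun k => ‖f k x‖ₑ ^ s) atTop (𝓝 (‖f₀ x‖ₑ ^ s)) :=
          (ENNReal.continuous_rpow_const.tendsto _).comp (hx.enorm)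
        exact this.liminf_eq.ge
    _ ≤ liminf (fun k => ∫⁻ x, ‖f k x‖ₑ ^ s ∂μ) atTop :=
        lintegral_liminf_le' fun k => (hf k).enorm.pow_const s
    _ ≤ C := liminf_le_of_le (by isBoundedDefault) fun b hb => by
        obtain ⟨k, hk⟩ := hb.exists
        exact hk.trans (hC k)

/-! ### Local Poincaré and Sobolev inequalities -/

section Euclidean
variable {n : ℕ}
local notation "𝔼" => EuclideanSpace ℝ (Fin n)

theorem lintegral_fderiv_mollify_rpow_le {u : 𝔼 → ℝ} {g : 𝔼 → 𝔼} (h : HasWeakGradient u g)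
    {s : ℝ} (hs : 1 ≤ s) (R : ℝ) (k : ℕ) :
    ∫⁻ x in Metric.ball 0 R, ‖fderiv ℝ (mollify (bumpSeq 𝔼 k) u) x‖ₑ ^ s ≤
      ∫⁻ x in Metric.ball 0 (R + 1), ‖g x‖ₑ ^ s := by
  calc _ ≤ ∫⁻ x in Metric.ball 0 R, ‖mollify (bumpSeq 𝔼 k) g x‖ₑ ^ s := by
        gcongr with x
        exact enorm_fderiv_mollify_le _ h x
    _ ≤ _ := lintegral_mollify_rpow_le _ h.2.1 hs R
    _ ≤ _ := lintegral_mono_set (Metric.ball_subset_ball (by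
        linarith [bumpSeq_rOut_le (V := 𝔼) k]))

/-- The `C¹` estimate holds for every mollification and passes to the limit by Fatou. The extra `1`
in the radius absorbs the supports of the kernels. -/
theorem HasWeakGradient.lintegral_comp_sub_sub_rpow_le {u : 𝔼 → ℝ} {g : 𝔼 → 𝔼}
    (h : HasWeakGradient u g) {s : ℝ} (hs : 1 ≤ s) (R : ℝ) (z : 𝔼) :
    ∫⁻ x in Metric.ball 0 R, ‖u (x - z) - u x‖ₑ ^ s ≤
      ‖z‖ₑ ^ s * ∫⁻ x in Metric.ball 0 (R + ‖z‖ + 1), ‖g x‖ₑ ^ s := by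
  refine lintegral_enorm_rpow_le_of_ae_tendsto
    (f := fun k x => mollify (bumpSeq 𝔼 k) u (x - z) - mollify (bumpSeq 𝔼 k) u x) ?_ ?_ ?_
  · intro k
    have := (contDiff_mollify (bumpSeq 𝔼 k) h.1).continuous
    exact (by fun_prop : Continuous fun x => mollify (bumpSeq 𝔼 k) u (x - z) -
      mollify (bumpSeq 𝔼 k) u x).aestronglyMeasurable
  · refine ae_restrict_of_ae ?_
    have h1 := ae_tendsto_mollify h.1
    filter_upwards [h1, (measurePreserving_sub_right volume z).quasiMeasurePreserving.ae h1]
      with x hx hx'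
    exact hx'.sub hx
  · intro k
    refine (lintegral_comp_sub_sub_rpow_le_of_contDiff (contDiff_mollify _ h.1) hs R z).trans ?_
    exact mul_le_mul_right (lintegral_fderiv_mollify_rpow_le h hs _ k) _

/-- The **Poincaré inequality** on balls. -/
theorem exists_poincare {s : ℝ} (hs : 1 ≤ s) {R : ℝ} (hR : 0 < R) :
    ∃ C : ℝ≥0∞, C ≠ ⊤ ∧ ∀ (u : 𝔼 → ℝ) (g : 𝔼 → 𝔼), HasWeakGradient u g → ∃ c : ℝ,
      ∫⁻ x in Metric.ball 0 R, ‖u x - c‖ₑ ^ s ≤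
        C * ∫⁻ x in Metric.ball 0 (3 * R + 1), ‖g x‖ₑ ^ s := by
  set D : ℝ≥0∞ := volume (Metric.ball (0 : 𝔼) (2 * R)) * ENNReal.ofReal (2 * R) ^ s
  have hB0 : volume (Metric.ball (0 : 𝔼) R) ≠ 0 := (Metric.measure_ball_pos _ _ hR).ne'
  have hBt : volume (Metric.ball (0 : 𝔼) R) ≠ ⊤ := measure_ball_lt_top.ne
  refine ⟨D / volume (Metric.ball (0 : 𝔼) R), ENNReal.div_ne_top (ENNReal.mul_ne_top
    measure_ball_lt_top.ne (ENNReal.rpow_ne_top_of_nonneg (by linarith) ENNReal.ofReal_ne_top))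
    hB0, fun u g h => ?_⟩
  set B := Metric.ball (0 : 𝔼) R
  set G := ∫⁻ x in Metric.ball 0 (3 * R + 1), ‖g x‖ₑ ^ s
  have hum := h.1.aestronglyMeasurable
  have hmeas : AEMeasurable (fun q : 𝔼 × 𝔼 => ‖u q.1 - u q.2‖ₑ ^ s)
      ((volume.restrict B).prod (volume.restrict B)) := by
    have h1 := hum.restrict (s := B)
    exact ((h1.comp_fst.sub h1.comp_snd).enorm).pow_const s
  have hmeas' : AEMeasurable (fun q : 𝔼 × 𝔼 => ‖u (q.1 - q.2) - u q.1‖ₑ ^ s)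
      ((volume.restrict B).prod (volume.restrict (Metric.ball 0 (2 * R)))) :=
    ((aestronglyMeasurable_sub_prod hum Measure.restrict_le_self.absolutelyContinuous
      Measure.restrict_le_self.absolutelyContinuous).sub
        (hum.restrict (s := B)).comp_fst).enorm.pow_const s
  -- Substituting `y = x - z` turns the double integral into translation errors with `‖z‖ < 2R`;
  -- these involve `g` only within radius `R + 2R + 1`.
  have hdouble : ∫⁻ y in B, ∫⁻ x in B, ‖u x - u y‖ₑ ^ s ≤ D * G := by
    calc ∫⁻ y in B, ∫⁻ x in B, ‖u x - u y‖ₑ ^ s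
        = ∫⁻ x in B, ∫⁻ y in B, ‖u x - u y‖ₑ ^ s := (lintegral_lintegral_swap hmeas).symm
      _ ≤ ∫⁻ x in B, ∫⁻ z in Metric.ball 0 (2 * R), ‖u (x - z) - u x‖ₑ ^ s := by
          refine setLIntegral_mono' Metric.isOpen_ball.measurableSet fun x hx => ?_
          rw [← lintegral_indicator Metric.isOpen_ball.measurableSet,
            ← lintegral_indicator Metric.isOpen_ball.measurableSet,
            ← lintegral_sub_left_eq_self _ x]
          refine lintegral_mono fun z => ?_
          by_cases hz : x - z ∈ B
          · have : z ∈ Metric.ball (0 : 𝔼) (2 * R) := by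
              have hx' : ‖x‖ < R := by simpa [B] using hx
              have hz' : ‖x - z‖ < R := by simpa [B] using hz
              have := norm_sub_le x (x - z)
              simp only [sub_sub_cancel] at this
              simp; linarith
            rw [Set.indicator_of_mem hz, Set.indicator_of_mem this, ← enorm_neg, neg_sub]
          · rw [Set.indicator_of_notMem hz]; exact zero_le
      _ = ∫⁻ z in Metric.ball 0 (2 * R), ∫⁻ x in B, ‖u (x - z) - u x‖ₑ ^ s :=
          lintegral_lintegral_swap hmeas'
      _ ≤ ∫⁻ z in Metric.ball (0 : 𝔼) (2 * R), ENNReal.ofReal (2 * R) ^ s * G := by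
          refine setLIntegral_mono' Metric.isOpen_ball.measurableSet fun z hz => ?_
          have hz' : ‖z‖ ≤ 2 * R := by simpa using (Metric.mem_ball.1 hz).le
          refine (h.lintegral_comp_sub_sub_rpow_le hs R z).trans ?_
          refine mul_le_mul' (ENNReal.rpow_le_rpow ?_ (by linarith))
            (lintegral_mono_set (Metric.ball_subset_ball (by linarith)))
          rw [← ofReal_norm]
          exact ENNReal.ofReal_le_ofReal hz'
      _ = D * G := by
          rw [lintegral_const, Measure.restrict_apply_univ]; simp only [D]; ring
  -- At some `y` the inner integral is at most its average over the ball, and `u y` then serves as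
  -- the constant.
  obtain ⟨y, -, hy⟩ := exists_le_setLAverage hB0 hBt (AEMeasurable.lintegral_prod_left' hmeas)
  refine ⟨u y, hy.trans ?_⟩
  rw [setLAverage_eq, ← ENNReal.mul_div_right_comm]
  exact ENNReal.div_le_div_right hdouble _

theorem eLpNorm_restrict_ball_mollify_le {F : Type*} [NormedAddCommGroup F] [NormedSpace ℝ F]
    [CompleteSpace F] {u : 𝔼 → F} (hu : LocallyIntegrable u volume) {s : ℝ≥0} (hs : 1 ≤ s)
    (R : ℝ) (k : ℕ) :
    eLpNorm (mollify (bumpSeq 𝔼 k) u) s (volume.restrict (Metric.ball 0 R)) ≤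
      eLpNorm u s (volume.restrict (Metric.ball 0 (R + 1))) := by
  have hs0 : s ≠ 0 := (zero_lt_one.trans_le hs).ne'
  rw [eLpNorm_nnreal_eq_lintegral hs0, eLpNorm_nnreal_eq_lintegral hs0]
  refine ENNReal.rpow_le_rpow ?_ (by positivity)
  exact (lintegral_mollify_rpow_le (bumpSeq 𝔼 k) hu hs R).trans
    (lintegral_mono_set (Metric.ball_subset_ball (by linarith [bumpSeq_rOut_le (V := 𝔼) k])))

theorem eLpNorm_fderiv_mul_le {η f : 𝔼 → ℝ} (hη : ContDiff ℝ 1 η) (hf : ContDiff ℝ 1 f)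
    (hη1 : ∀ x, ‖η x‖ ≤ 1) {K : ℝ≥0} (hK : ∀ x, ‖fderiv ℝ η x‖ ≤ K) {s : ℝ≥0∞} (hs : 1 ≤ s)
    (μ : Measure 𝔼) :
    eLpNorm (fderiv ℝ (fun x => η x * f x)) s μ ≤
      (1 + K) * (eLpNorm f s μ + eLpNorm (fderiv ℝ f) s μ) := by
  have hfd : ∀ x, fderiv ℝ (fun x => η x * f x) x = η x • fderiv ℝ f x + f x • fderiv ℝ η x :=
    fun x => fderiv_fun_mul (hη.differentiable one_ne_zero x) (hf.differentiable one_ne_zero x)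
  have e1 : eLpNorm (fderiv ℝ (fun x => η x * f x)) s μ ≤
      eLpNorm ((fun x => ‖fderiv ℝ f x‖) + fun x => K * ‖f x‖) s μ := by
    refine eLpNorm_mono_real fun x => ?_
    rw [hfd]
    refine (norm_add_le _ _).trans (add_le_add ?_ ?_)
    · rw [norm_smul]
      exact mul_le_of_le_one_left (norm_nonneg _) (hη1 x)
    · rw [norm_smul, mul_comm]
      exact mul_le_mul_of_nonneg_right (hK x) (norm_nonneg _)
  have e2 : eLpNorm (fun x => K * ‖f x‖) s μ ≤ K * eLpNorm f s μ := by
    rw [← ENNReal.ofReal_coe_nnreal]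
    refine eLpNorm_le_mul_eLpNorm_of_ae_le_mul (ae_of_all _ fun x => ?_) _
    rw [Real.norm_of_nonneg (by positivity)]
  have e3 := e1.trans (eLpNorm_add_le
    (hf.continuous_fderiv one_ne_zero).norm.aestronglyMeasurable
    (continuous_const.mul hf.continuous.norm).aestronglyMeasurable hs)
  rw [eLpNorm_norm] at e3
  calc _ ≤ eLpNorm (fderiv ℝ f) s μ + K * eLpNorm f s μ := e3.trans (by gcongr)
    _ ≤ (1 + K) * eLpNorm (fderiv ℝ f) s μ + (1 + K) * eLpNorm f s μ := by
      gcongr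
      · exact le_mul_of_one_le_left zero_le le_self_add
      · exact le_add_self
    _ = _ := by ring

/-- Multiplication by a cutoff equal to `1` on the small ball reduces this to the
Gagliardo–Nirenberg–Sobolev inequality for compactly supported functions; the derivative of the
cutoff produces the lower-order term. -/
theorem exists_sobolev_of_contDiff (hn : 0 < n) {s s' : ℝ≥0} (hs : 1 ≤ s)
    (hs' : (s' : ℝ)⁻¹ = (s : ℝ)⁻¹ - (n : ℝ)⁻¹) {R : ℝ} (hR : 0 < R) :
    ∃ C : ℝ≥0∞, C ≠ ⊤ ∧ ∀ f : 𝔼 → ℝ, ContDiff ℝ 1 f →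
      eLpNorm f s' (volume.restrict (Metric.ball 0 R)) ≤
        C * (eLpNorm f s (volume.restrict (Metric.ball 0 (R + 2))) +
          eLpNorm (fderiv ℝ f) s (volume.restrict (Metric.ball 0 (R + 2)))) := by
  obtain ⟨η, hη, hη1, hηc, hηsupp, hηR⟩ : ∃ η : 𝔼 → ℝ, ContDiff ℝ 1 η ∧ (∀ x, ‖η x‖ ≤ 1) ∧
      HasCompactSupport η ∧ tsupport η ⊆ Metric.ball 0 (R + 2) ∧
      ∀ x ∈ Metric.ball 0 R, η x = 1 := by
    let η : ContDiffBump (0 : 𝔼) := ⟨R, R + 1, hR, by linarith⟩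
    refine ⟨η, η.contDiff, fun x => ?_, η.hasCompactSupport, ?_, fun x hx =>
      η.one_of_mem_closedBall (Metric.ball_subset_closedBall hx)⟩
    · rw [Real.norm_of_nonneg η.nonneg]
      exact η.le_one
    · rw [η.tsupport_eq]
      exact Metric.closedBall_subset_ball (by simp [η])
  obtain ⟨K, hK⟩ := (hηc.fderiv ℝ).exists_bound_of_continuous (hη.continuous_fderiv one_ne_zero)
  lift K to ℝ≥0 using (norm_nonneg _).trans (hK 0)
  obtain ⟨A, hA⟩ : ∃ A : ℝ≥0, ∀ f : 𝔼 → ℝ, ContDiff ℝ 1 f → HasCompactSupport f →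
      eLpNorm f s' volume ≤ A * eLpNorm (fderiv ℝ f) s volume :=
    ⟨_, fun f hf hfc => eLpNorm_le_eLpNorm_fderiv_of_eq volume hf hfc hs (by simpa using hn)
      (by simpa using hs')⟩
  refine ⟨A * (1 + K), by finiteness, fun f hf => ?_⟩
  have hsub : Function.support (fderiv ℝ (fun x => η x * f x)) ⊆ Metric.ball 0 (R + 2) :=
    (support_fderiv_subset ℝ).trans ((tsupport_mul_subset_left).trans hηsupp)
  have hres : eLpNorm (fderiv ℝ (fun x => η x * f x)) s
      (volume.restrict (Metric.ball 0 (R + 2))) =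
      eLpNorm (fderiv ℝ (fun x => η x * f x)) s volume := by
    rw [← eLpNorm_norm, ← eLpNorm_norm (μ := volume)]
    refine eLpNorm_restrict_eq_of_support_subset fun x hx => hsub ?_
    simpa using hx
  calc eLpNorm f s' (volume.restrict (Metric.ball 0 R))
      = eLpNorm (fun x => η x * f x) s' (volume.restrict (Metric.ball 0 R)) := by
        refine eLpNorm_congr_ae ?_
        filter_upwards [ae_restrict_mem Metric.isOpen_ball.measurableSet] with x hx
        rw [hηR x hx, one_mul]
    _ ≤ eLpNorm (fun x => η x * f x) s' volume := eLpNorm_mono_measure _ Measure.restrict_le_self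
    _ ≤ A * eLpNorm (fderiv ℝ (fun x => η x * f x)) s volume := hA _ (hη.mul hf) hηc.mul_right
    _ = A * eLpNorm (fderiv ℝ (fun x => η x * f x)) s
          (volume.restrict (Metric.ball 0 (R + 2))) := by
        rw [hres]
    _ ≤ A * ((1 + K) * (eLpNorm f s (volume.restrict (Metric.ball 0 (R + 2))) +
          eLpNorm (fderiv ℝ f) s (volume.restrict (Metric.ball 0 (R + 2))))) :=
        mul_le_mul_right (eLpNorm_fderiv_mul_le hη hf hη1 hK (by exact_mod_cast hs) _) _
    _ = _ := (mul_assoc _ _ _).symm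

/-- A local form of the **Sobolev inequality**. -/
theorem exists_sobolev (hn : 0 < n) {s s' : ℝ≥0} (hs : 1 ≤ s) (hs'0 : s' ≠ 0)
    (hs' : (s' : ℝ)⁻¹ = (s : ℝ)⁻¹ - (n : ℝ)⁻¹) {R : ℝ} (hR : 0 < R) :
    ∃ C : ℝ≥0∞, C ≠ ⊤ ∧ ∀ (u : 𝔼 → ℝ) (g : 𝔼 → 𝔼), HasWeakGradient u g →
      eLpNorm u s' (volume.restrict (Metric.ball 0 R)) ≤
        C * (eLpNorm u s (volume.restrict (Metric.ball 0 (R + 3))) +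
          eLpNorm g s (volume.restrict (Metric.ball 0 (R + 3)))) := by
  obtain ⟨C, hC, hCf⟩ := exists_sobolev_of_contDiff hn hs hs' hR
  refine ⟨C, hC, fun u g h => ?_⟩
  set D := C * (eLpNorm u s (volume.restrict (Metric.ball 0 (R + 3))) +
          eLpNorm g s (volume.restrict (Metric.ball 0 (R + 3))))
  have key : ∀ k, eLpNorm (mollify (bumpSeq 𝔼 k) u) s' (volume.restrict (Metric.ball 0 R)) ≤ D := by
    intro k
    refine (hCf _ (contDiff_mollify _ h.1)).trans ?_
    have e : R + 3 = R + 2 + 1 := by ring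
    simp only [D]
    rw [e]
    gcongr
    · exact eLpNorm_restrict_ball_mollify_le h.1 hs _ k
    · refine le_trans ?_ (eLpNorm_restrict_ball_mollify_le h.2.1 hs _ k)
      exact eLpNorm_mono_enorm fun x => enorm_fderiv_mollify_le _ h x
  have hs'pos : (0 : ℝ) < s' := by positivity
  rw [eLpNorm_nnreal_eq_lintegral hs'0, one_div, ENNReal.rpow_inv_le_iff hs'pos]
  refine lintegral_enorm_rpow_le_of_ae_tendsto (f := fun k => mollify (bumpSeq 𝔼 k) u)
    (fun k => (contDiff_mollify _ h.1).continuous.aestronglyMeasurable)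
    (ae_restrict_of_ae (ae_tendsto_mollify h.1)) fun k => ?_
  rw [← ENNReal.rpow_inv_le_iff hs'pos, ← one_div, ← eLpNorm_nnreal_eq_lintegral hs'0]
  exact key k

end Euclidean

/-! ### Total boundedness and Arzelà–Ascoli for mollifications -/

/-- A finite net for the auxiliary family `F` pulls back to a finite `ε`-net for `U`. The auxiliary
family may depend on `ε`, as the mollification scale does in Rellich's theorem. -/
theorem totallyBounded_range_of_forall_exists {ι X : Type*} [Nonempty ι] [PseudoMetricSpace X] (U : ι → X)
    (H : ∀ ε > 0, ∃ (Y : Type) (_ : PseudoMetricSpace Y) (F : ι → Y), TotallyBounded (Set.range F) ∧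
      ∃ δ > 0, ∀ k l, dist (F k) (F l) < δ → dist (U k) (U l) < ε) :
    TotallyBounded (Set.range U) := by
  rw [Metric.totallyBounded_iff]
  intro ε hε
  obtain ⟨Y, _, F, hF, δ, hδ, hFU⟩ := H ε hε
  obtain ⟨t, htF, htfin, ht⟩ := Metric.finite_approx_of_totallyBounded hF δ hδ
  choose! r hr using fun y (hy : y ∈ t) => htF hy
  refine ⟨(fun y => U (r y)) '' t, htfin.image _, ?_⟩
  rintro _ ⟨k, rfl⟩
  obtain ⟨y, hy, hky⟩ := Set.mem_iUnion₂.1 (ht ⟨k, rfl⟩)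
  refine Set.mem_iUnion₂.2 ⟨U (r y), ⟨y, hy, rfl⟩, hFU _ _ ?_⟩
  rw [hr y hy]
  exact hky

section Smooth
variable {V : Type*} [NormedAddCommGroup V] [NormedSpace ℝ V] [FiniteDimensional ℝ V]
  [MeasureSpace V] [BorelSpace V] [(volume : Measure V).IsAddHaarMeasure]

theorem normed_sub_eq_zero (φ : ContDiffBump (0 : V)) {R : ℝ} {x y : V}
    (hx : x ∈ Metric.closedBall 0 R) (hy : y ∉ Metric.ball 0 (R + φ.rOut)) :
    φ.normed volume (x - y) = 0 := by
  have : x - y ∉ Function.support (φ.normed volume) := by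
    rw [φ.support_normed_eq]
    simp only [Metric.mem_closedBall, dist_zero_right, Metric.mem_ball, not_lt] at hx hy ⊢
    have := norm_sub_norm_le y x
    rw [norm_sub_rev] at this
    linarith
  exact Function.notMem_support.1 this

theorem exists_enorm_mollify_le (φ : ContDiffBump (0 : V)) (R : ℝ) :
    ∃ K : ℝ≥0, ∀ (u : V → ℝ), ∀ x ∈ Metric.closedBall 0 R,
      ‖mollify φ u x‖ₑ ≤ K * ∫⁻ y in Metric.ball 0 (R + φ.rOut), ‖u y‖ₑ := by
  obtain ⟨K, hK⟩ := (φ.hasCompactSupport_normed (μ := volume)).exists_bound_of_continuous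
    φ.continuous_normed
  lift K to ℝ≥0 using (norm_nonneg _).trans (hK 0)
  refine ⟨K, fun u x hx => ?_⟩
  rw [mollify, convolution_eq_swap, ← lintegral_const_mul' _ _ ENNReal.coe_ne_top,
    ← lintegral_indicator Metric.isOpen_ball.measurableSet]
  refine (enorm_integral_le_lintegral_enorm _).trans (lintegral_mono fun y => ?_)
  by_cases hy : y ∈ Metric.ball 0 (R + φ.rOut)
  · rw [Set.indicator_of_mem hy, ContinuousLinearMap.lsmul_apply, enorm_smul]
    gcongr
    exact enorm_le_coe.2 (hK _)
  · simp [normed_sub_eq_zero φ hx hy]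

/-- The Lipschitz constant of the kernel controls all mollifications at once; this supplies the
equicontinuity for Arzelà–Ascoli. -/
theorem exists_enorm_mollify_sub_mollify_le (φ : ContDiffBump (0 : V)) (R : ℝ) :
    ∃ K : ℝ≥0, ∀ (u : V → ℝ), LocallyIntegrable u volume → ∀ x ∈ Metric.closedBall 0 R,
      ∀ x' ∈ Metric.closedBall 0 R, ‖mollify φ u x - mollify φ u x'‖ₑ ≤
        K * edist x x' * ∫⁻ y in Metric.ball 0 (R + φ.rOut), ‖u y‖ₑ := by
  obtain ⟨K, hK⟩ := ContDiff.lipschitzWith_of_hasCompactSupport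
    (φ.hasCompactSupport_normed (μ := volume)) (φ.contDiff_normed (n := 1)) one_ne_zero
  refine ⟨K, fun u hu x hx x' hx' => ?_⟩
  have hex : ∀ x, Integrable (fun y => φ.normed volume (x - y) • u y) := fun x =>
    (φ.hasCompactSupport_normed.convolutionExists_left (lsmul ℝ ℝ) φ.continuous_normed hu
      x).integrable_swap
  have : mollify φ u x - mollify φ u x' =
      ∫ y, (φ.normed volume (x - y) - φ.normed volume (x' - y)) • u y := by
    simp_rw [sub_smul]
    rw [integral_sub (hex x) (hex x'), mollify, convolution_eq_swap, convolution_eq_swap]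
    rfl
  rw [this, ← lintegral_const_mul' _ _ (by finiteness),
    ← lintegral_indicator Metric.isOpen_ball.measurableSet]
  refine (enorm_integral_le_lintegral_enorm _).trans (lintegral_mono fun y => ?_)
  by_cases hy : y ∈ Metric.ball 0 (R + φ.rOut)
  · rw [Set.indicator_of_mem hy, enorm_smul]
    gcongr
    rw [← edist_eq_enorm_sub]
    refine (hK _ _).trans_eq ?_
    simp
  · simp [normed_sub_eq_zero φ hx hy, normed_sub_eq_zero φ hx' hy]

/-- Mollifications of a sequence which is bounded in `L¹` are totally bounded with respect to
uniform convergence on balls. -/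
theorem exists_boundedContinuousFunction_mollify (φ : ContDiffBump (0 : V)) (R : ℝ)
    {u : ℕ → V → ℝ} (hu : ∀ k, LocallyIntegrable (u k) volume) {M : ℝ≥0}
    (hM : ∀ k, ∫⁻ y in Metric.ball 0 (R + φ.rOut), ‖u k y‖ₑ ≤ M) :
    ∃ F : ℕ → (Metric.closedBall (0 : V) R →ᵇ ℝ), (∀ k x, F k x = mollify φ (u k) x) ∧
      TotallyBounded (Set.range F) := by
  have : CompactSpace (Metric.closedBall (0 : V) R) :=
    isCompact_iff_compactSpace.1 (isCompact_closedBall _ _)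
  refine ⟨fun k => BoundedContinuousFunction.mkOfCompact
    ⟨fun x => mollify φ (u k) x, (contDiff_mollify φ (hu k)).continuous.comp
      continuous_subtype_val⟩, fun _ _ => rfl, ?_⟩
  obtain ⟨K, hK⟩ := exists_enorm_mollify_le φ R
  obtain ⟨L, hL⟩ := exists_enorm_mollify_sub_mollify_le φ R
  refine TotallyBounded.subset subset_closure (BoundedContinuousFunction.arzela_ascoli
    (Metric.closedBall 0 (K * M)) (isCompact_closedBall _ _) _ ?_ ?_).totallyBounded
  · rintro _ x ⟨k, rfl⟩
    have : ‖mollify φ (u k) x‖ₑ ≤ ((K * M : ℝ≥0) : ℝ≥0∞) := by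
      rw [ENNReal.coe_mul]
      exact (hK (u k) x x.2).trans (mul_le_mul_right (hM k) _)
    rw [mem_closedBall_zero_iff]
    exact_mod_cast enorm_le_coe.1 this
  · refine (LipschitzWith.uniformEquicontinuous _ (L * M) ?_).equicontinuous
    rintro ⟨_, k, rfl⟩ x y
    rw [edist_eq_enorm_sub]
    refine (hL (u k) (hu k) x x.2 y y.2).trans ?_
    rw [ENNReal.coe_mul, mul_assoc, mul_assoc, mul_comm (M : ℝ≥0∞)]
    gcongr
    exacts [le_rfl, hM k]

end Smooth

/-! ### The Rellich–Kondrachov theorem -/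

section Euclidean
variable {n : ℕ}
local notation "𝔼" => EuclideanSpace ℝ (Fin n)

/-- The error is an average of translation errors with `‖z‖ ≤ φ.rOut`, so the `L¹` rate depends on
`u` only through its gradient. -/
theorem HasWeakGradient.lintegral_mollify_sub_le {u : 𝔼 → ℝ} {g : 𝔼 → 𝔼}
    (h : HasWeakGradient u g) (φ : ContDiffBump (0 : 𝔼)) (hφ : φ.rOut ≤ 1) (R : ℝ) :
    ∫⁻ x in Metric.ball 0 R, ‖mollify φ u x - u x‖ₑ ≤
      ENNReal.ofReal φ.rOut * ∫⁻ x in Metric.ball 0 (R + 2), ‖g x‖ₑ := by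
  have hum := h.1.aestronglyMeasurable
  have := lintegral_rpow_le_of_le_lintegral (s := 1) (μ := volume.restrict (Metric.ball 0 R))
    (m := bumpMeasure φ) (N := fun x => ‖mollify φ u x - u x‖ₑ)
    (h := fun x z => ‖u (x - z) - u x‖ₑ)
    (C := ENNReal.ofReal φ.rOut * ∫⁻ x in Metric.ball 0 (R + 2), ‖g x‖ₑ) le_rfl
    ((aestronglyMeasurable_sub_prod hum Measure.restrict_le_self.absolutelyContinuous
      (bumpMeasure_absolutelyContinuous φ)).sub hum.restrict.comp_fst).enorm
    (ae_of_all _ fun x => enorm_mollify_sub_le φ h.1 x (u x)) ?_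
  · simpa using this
  filter_upwards [bumpMeasure_ae_norm_le φ] with z hz
  refine (h.lintegral_comp_sub_sub_rpow_le le_rfl R z).trans ?_
  simp only [ENNReal.rpow_one]
  refine mul_le_mul' ?_ (lintegral_mono_set (Metric.ball_subset_ball (by linarith)))
  rw [← ofReal_norm]
  exact ENNReal.ofReal_le_ofReal hz

/-- The **Rellich–Kondrachov theorem** on balls, with almost everywhere convergence. -/
theorem exists_strictMono_ae_tendsto {u : ℕ → 𝔼 → ℝ} {g : ℕ → 𝔼 → 𝔼}
    (h : ∀ k, HasWeakGradient (u k) (g k)) (R : ℝ) {M : ℝ≥0}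
    (hu : ∀ k, ∫⁻ x in Metric.ball 0 (R + 1), ‖u k x‖ₑ ≤ M)
    (hg : ∀ k, ∫⁻ x in Metric.ball 0 (R + 2), ‖g k x‖ₑ ≤ M) :
    ∃ (f : 𝔼 → ℝ) (σ : ℕ → ℕ), StrictMono σ ∧
      ∀ᵐ x ∂(volume.restrict (Metric.ball 0 R)), Tendsto (fun k => u (σ k) x) atTop (𝓝 (f x)) := by
  set μ := volume.restrict (Metric.ball (0 : 𝔼) R)
  have hmem : ∀ k, MemLp (u k) 1 μ := fun k => memLp_one_iff_integrable.2
    (((h k).1.integrableOn_isCompact (isCompact_closedBall 0 R)).mono_set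
      Metric.ball_subset_closedBall)
  have htb : TotallyBounded (Set.range fun k => (hmem k).toLp (u k)) := by
    refine totallyBounded_range_of_forall_exists _ fun ε hε => ?_
    set b := (volume (Metric.ball (0 : 𝔼) R)).toReal
    have hb : 0 ≤ b := ENNReal.toReal_nonneg
    -- The two mollification errors and the uniform error sum to at most `δ(2M + b)`, which is below
    -- `ε`.
    set δ := ε / (4 * (M + b + 1))
    have hδ : 0 < δ := by positivity
    obtain ⟨m, hm⟩ := ((tendsto_bumpSeq_rOut (V := 𝔼)).eventually_lt_const hδ).exists
    set φ := bumpSeq 𝔼 m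
    have hφ1 : φ.rOut ≤ 1 := bumpSeq_rOut_le m
    obtain ⟨F, hF, hFtb⟩ := exists_boundedContinuousFunction_mollify φ R (fun k => (h k).1)
      (M := M) fun k => (lintegral_mono_set (Metric.ball_subset_ball (by linarith))).trans (hu k)
    refine ⟨_, inferInstance, F, hFtb, δ, hδ, fun k l hkl => ?_⟩
    have hmoll : ∀ k, ∫⁻ x, ‖mollify φ (u k) x - u k x‖ₑ ∂μ ≤ ENNReal.ofReal (δ * M) := by
      intro k
      refine ((h k).lintegral_mollify_sub_le φ hφ1 R).trans ?_
      rw [ENNReal.ofReal_mul hδ.le, ENNReal.ofReal_coe_nnreal]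
      gcongr
      exact hg k
    have hunif : ∫⁻ x, ‖mollify φ (u k) x - mollify φ (u l) x‖ₑ ∂μ ≤ ENNReal.ofReal (δ * b) := by
      calc _ ≤ ∫⁻ _, ENNReal.ofReal δ ∂μ := by
            refine setLIntegral_mono' Metric.isOpen_ball.measurableSet fun x hx => ?_
            have := (F k).dist_coe_le_dist (g := F l) ⟨x, Metric.ball_subset_closedBall hx⟩
            rw [hF, hF, Real.dist_eq] at this
            rw [← ofReal_norm, Real.norm_eq_abs]
            exact ENNReal.ofReal_le_ofReal (this.trans hkl.le)
        _ = ENNReal.ofReal (δ * b) := by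
            rw [lintegral_const, ENNReal.ofReal_mul hδ.le, Measure.restrict_apply_univ,
              ENNReal.ofReal_toReal measure_ball_lt_top.ne]
    have hmm : ∀ k, AEMeasurable (fun x => ‖mollify φ (u k) x - u k x‖ₑ) μ := fun k =>
      ((contDiff_mollify φ (h k).1).continuous.aestronglyMeasurable.sub (hmem k).1).enorm
    have hd : edist ((hmem k).toLp (u k)) ((hmem l).toLp (u l)) < ENNReal.ofReal ε := by
      rw [Lp.edist_toLp_toLp, eLpNorm_one_eq_lintegral_enorm]
      calc ∫⁻ x, ‖(u k - u l) x‖ₑ ∂μ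
          ≤ ∫⁻ x, (‖mollify φ (u k) x - u k x‖ₑ + (‖mollify φ (u l) x - u l x‖ₑ +
              ‖mollify φ (u k) x - mollify φ (u l) x‖ₑ)) ∂μ := by
            refine lintegral_mono fun x => ?_
            have : (u k - u l) x = -(mollify φ (u k) x - u k x) + ((mollify φ (u l) x - u l x) +
              (mollify φ (u k) x - mollify φ (u l) x)) := by simp only [Pi.sub_apply]; ring
            rw [this]
            refine (enorm_add_le _ _).trans ?_
            rw [enorm_neg]
            gcongr
            exact enorm_add_le _ _
        _ ≤ ENNReal.ofReal (δ * M) + (ENNReal.ofReal (δ * M) + ENNReal.ofReal (δ * b)) := by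
            rw [lintegral_add_left' (hmm k), lintegral_add_left' (hmm l)]
            gcongr
            exacts [hmoll k, hmoll l]
        _ = ENNReal.ofReal (δ * M + (δ * M + δ * b)) := by
            rw [ENNReal.ofReal_add (by positivity) (by positivity),
              ENNReal.ofReal_add (by positivity) (by positivity)]
        _ < ENNReal.ofReal ε := by
            rw [ENNReal.ofReal_lt_ofReal_iff hε]
            have : δ * (4 * (M + b + 1)) = ε := by
              simp only [δ]
              field_simp
            nlinarith [mul_nonneg hδ.le hb, mul_nonneg hδ.le M.coe_nonneg]
    rw [Lp.edist_dist] at hd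
    exact (ENNReal.ofReal_lt_ofReal_iff hε).1 hd
  obtain ⟨f, -, σ, hσ, hlim⟩ := (htb.closure.isCompact_of_isClosed
    isClosed_closure).tendsto_subseq
    (x := fun k => (hmem k).toLp (u k)) fun k => subset_closure ⟨k, rfl⟩
  -- `L¹` convergence gives convergence in measure, hence almost everywhere along a further
  -- subsequence.
  obtain ⟨τ, hτ, hae⟩ := (tendstoInMeasure_of_tendsto_Lp hlim).exists_seq_tendsto_ae
  refine ⟨f, σ ∘ τ, hσ.comp hτ, ?_⟩
  filter_upwards [hae, ae_all_iff.2 fun k => (hmem k).coeFn_toLp] with x hx hx'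
  refine hx.congr fun k => ?_
  simp only [Function.comp_apply]
  rw [hx']

end Euclidean

/-! ### Hölder's inequality for weighted norms -/

theorem holderTriple_ofReal {a b c : ℝ} (ha : 0 < a) (hb : 0 < b) (hc : 0 < c)
    (h : a⁻¹ + b⁻¹ = c⁻¹) :
    ENNReal.HolderTriple (ENNReal.ofReal a) (ENNReal.ofReal b) (ENNReal.ofReal c) := by
  constructor
  rw [← ENNReal.ofReal_inv_of_pos ha, ← ENNReal.ofReal_inv_of_pos hb,
    ← ENNReal.ofReal_inv_of_pos hc, ← ENNReal.ofReal_add (by positivity) (by positivity), h]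

/-- Integrability is assumed for `v^β` only, so measurability of `v` has to be recovered by taking a
root. -/
theorem aestronglyMeasurable_of_rpow {X : Type*} [MeasurableSpace X] {μ : Measure X} {h : X → ℝ}
    {γ : ℝ} (hγ : γ ≠ 0) (h0 : ∀ᵐ x ∂μ, 0 ≤ h x)
    (hm : AEStronglyMeasurable (fun x => h x ^ γ) μ) : AEStronglyMeasurable h μ := by
  have : AEMeasurable (fun x => (h x ^ γ) ^ γ⁻¹) μ := hm.aemeasurable.pow_const _
  refine this.aestronglyMeasurable.congr ?_
  filter_upwards [h0] with x hx
  rw [← Real.rpow_mul hx, mul_inv_cancel₀ hγ, Real.rpow_one]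

theorem memLp_rpow_of_integrable_rpow {X : Type*} [MeasurableSpace X] {μ : Measure X} {h : X → ℝ}
    {γ r : ℝ} (hr : 0 < r) (h0 : ∀ᵐ x ∂μ, 0 ≤ h x) (hi : Integrable (fun x => h x ^ γ) μ) :
    MemLp (fun x => h x ^ (γ / r)) (ENNReal.ofReal r) μ := by
  have e : ∀ᵐ x ∂μ, (h x ^ γ) ^ r⁻¹ = h x ^ (γ / r) := by
    filter_upwards [h0] with x hx
    rw [← Real.rpow_mul hx, div_eq_mul_inv]
  refine ⟨(hi.1.aemeasurable.pow_const r⁻¹).aestronglyMeasurable.congr e, ?_⟩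
  rw [eLpNorm_lt_top_iff_lintegral_rpow_enorm_lt_top (by simpa using hr) ENNReal.ofReal_ne_top,
    ENNReal.toReal_ofReal hr.le]
  refine lt_of_le_of_lt (lintegral_mono_ae ?_) hi.2
  filter_upwards [h0] with x hx
  rw [Real.enorm_of_nonneg (by positivity), ENNReal.ofReal_rpow_of_nonneg (by positivity) hr.le,
    ← Real.rpow_mul hx, div_mul_cancel₀ _ hr.ne', Real.enorm_of_nonneg (by positivity)]

section Weight
variable {n : ℕ}
local notation "𝔼" => EuclideanSpace ℝ (Fin n)

/-- The weight is moved into the function as `w^(1/r)`, so that Hölder's inequality applies with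
respect to Lebesgue measure. No measurability of `f` is needed, since the density is finite. -/
theorem eLpNorm_weightedMeasure_restrict {F : Type*} [NormedAddCommGroup F] [NormedSpace ℝ F]
    {w : 𝔼 → ℝ} (hwm : AEStronglyMeasurable w volume) (hw0 : ∀ᵐ x, 0 ≤ w x) {r : ℝ} (hr : 0 < r)
    (f : 𝔼 → F) (A : Set 𝔼) :
    eLpNorm f (ENNReal.ofReal r) ((weightedMeasure w).restrict A) =
      eLpNorm ((fun x => w x ^ (1 / r)) • f) (ENNReal.ofReal r) (volume.restrict A) := by
  have hr0 : ENNReal.ofReal r ≠ 0 := by simpa using hr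
  rw [eLpNorm_eq_lintegral_rpow_enorm_toReal hr0 ENNReal.ofReal_ne_top,
    eLpNorm_eq_lintegral_rpow_enorm_toReal hr0 ENNReal.ofReal_ne_top, weightedMeasure,
    restrict_withDensity', lintegral_withDensity_eq_lintegral_mul_non_measurable₀ _
      hwm.aemeasurable.ennreal_ofReal.restrict (by simp), ENNReal.toReal_ofReal hr.le]
  congr 1
  refine lintegral_congr_ae ?_
  filter_upwards [ae_restrict_of_ae hw0] with x hx
  simp only [Pi.mul_apply, Pi.smul_apply', enorm_smul]
  rw [ENNReal.mul_rpow_of_nonneg _ _ hr.le,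
    Real.enorm_of_nonneg (by positivity), ENNReal.ofReal_rpow_of_nonneg (by positivity) hr.le,
    ← Real.rpow_mul hx, one_div, inv_mul_cancel₀ hr.ne', Real.rpow_one]

theorem weightedMeasure_absolutelyContinuous (w : 𝔼 → ℝ) : weightedMeasure w ≪ volume :=
  withDensity_absolutelyContinuous _ _

theorem absolutelyContinuous_weightedMeasure {w : 𝔼 → ℝ} (hwm : AEStronglyMeasurable w volume)
    (hw : ∀ᵐ x, 0 < w x) : volume ≪ weightedMeasure w :=
  withDensity_absolutelyContinuous' hwm.aemeasurable.ennreal_ofReal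
    (hw.mono fun x hx => by simpa using hx)

/-- If `w^{-α}` is locally integrable, then `Lᵖ(w dx)` embeds locally into `Lˢ(dx)`,
where `s = αp / (α + 1)`. -/
theorem exists_eLpNorm_ball_le_weighted {w : 𝔼 → ℝ} (hwm : AEStronglyMeasurable w volume)
    (hw : ∀ᵐ x, 0 < w x) {α p : ℝ} (hα : 0 < α) (hp : 0 < p)
    (hwα : LocallyIntegrable (fun x => w x ^ (-α)) volume) (R : ℝ) :
    ∃ C : ℝ≥0∞, C ≠ ⊤ ∧ ∀ {F : Type} [NormedAddCommGroup F] [NormedSpace ℝ F] (f : 𝔼 → F),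
      AEStronglyMeasurable f volume →
      eLpNorm f (ENNReal.ofReal (α * p / (α + 1))) (volume.restrict (Metric.ball 0 R)) ≤
        C * eLpNorm f (ENNReal.ofReal p) (weightedMeasure w) := by
  have hw0 : ∀ᵐ x, 0 ≤ w x := hw.mono fun _ => le_of_lt
  set μ := volume.restrict (Metric.ball (0 : 𝔼) R)
  have hi : Integrable (fun x => w x ^ (-α)) μ :=
    (hwα.integrableOn_isCompact (isCompact_closedBall 0 R)).mono_set Metric.ball_subset_closedBall
  have hmem := memLp_rpow_of_integrable_rpow (r := α * p) (by positivity)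
    (ae_restrict_of_ae hw0) hi
  have he : -α / (α * p) = -(1 / p) := by field_simp
  rw [he] at hmem
  refine ⟨_, hmem.2.ne, fun {F} _ _ f hf => ?_⟩
  have := holderTriple_ofReal (a := α * p) (b := p) (c := α * p / (α + 1)) (by positivity) hp
    (by positivity) (by field_simp; ring)
  calc eLpNorm f (ENNReal.ofReal (α * p / (α + 1))) μ
      = eLpNorm ((fun x => w x ^ (-(1 / p))) • ((fun x => w x ^ (1 / p)) • f))
          (ENNReal.ofReal (α * p / (α + 1))) μ := by
        refine eLpNorm_congr_ae ?_
        filter_upwards [ae_restrict_of_ae hw] with x hx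
        simp only [Pi.smul_apply', smul_smul]
        rw [← Real.rpow_add hx]
        simp
    _ ≤ eLpNorm (fun x => w x ^ (-(1 / p))) (ENNReal.ofReal (α * p)) μ *
          eLpNorm ((fun x => w x ^ (1 / p)) • f) (ENNReal.ofReal p) μ :=
        eLpNorm_smul_le_mul_eLpNorm
          (((hwm.aemeasurable.pow_const _).aestronglyMeasurable.smul hf).restrict) hmem.1
    _ = eLpNorm (fun x => w x ^ (-(1 / p))) (ENNReal.ofReal (α * p)) μ *
          eLpNorm f (ENNReal.ofReal p) ((weightedMeasure w).restrict (Metric.ball 0 R)) := by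
        rw [eLpNorm_weightedMeasure_restrict hwm hw0 hp]
    _ ≤ _ := mul_le_mul_right (eLpNorm_mono_measure _ Measure.restrict_le_self) _

/-- Hölder with exponents `qβ` and `qβ/(β-1)`, then inclusion of `L^s` on a ball of finite measure.
The factor `φ` is kept general so that it can also be a truncated weight. -/
theorem eLpNorm_smul_ofReal_le {β q s : ℝ} (hβ : 1 < β) (hq : 0 < q)
    (hqs : q * (β / (β - 1)) ≤ s) {E : Set 𝔼} {R : ℝ} (hER : E ⊆ Metric.ball 0 R)
    {φ f : 𝔼 → ℝ} (hφ : AEStronglyMeasurable φ (volume.restrict E))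
    (hf : AEStronglyMeasurable f (volume.restrict (Metric.ball 0 R))) :
    eLpNorm (φ • f) (ENNReal.ofReal q) (volume.restrict E) ≤
      eLpNorm φ (ENNReal.ofReal (q * β)) (volume.restrict E) *
        (eLpNorm f (ENNReal.ofReal s) (volume.restrict (Metric.ball 0 R)) *
          volume (Metric.ball (0 : 𝔼) R) ^ (1 / (q * (β / (β - 1))) - 1 / s)) := by
  have hβ1 : 0 < β - 1 := by linarith
  have hpos : 0 < q * (β / (β - 1)) := by positivity
  have := holderTriple_ofReal (a := q * β) (b := q * (β / (β - 1))) (c := q) (by positivity) hpos hq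
    (by field_simp; ring)
  refine (eLpNorm_smul_le_mul_eLpNorm (q := ENNReal.ofReal (q * (β / (β - 1)))) (hf.mono_measure
    (Measure.restrict_mono_set _ hER)) hφ).trans (mul_le_mul_right ?_ _)
  refine (eLpNorm_mono_measure _ (Measure.restrict_mono_set _ hER)).trans ?_
  have h := eLpNorm_le_eLpNorm_mul_rpow_measure_univ (ENNReal.ofReal_le_ofReal hqs) hf
  rwa [Measure.restrict_apply_univ, ENNReal.toReal_ofReal hpos.le,
    ENNReal.toReal_ofReal (hpos.le.trans hqs)] at h

theorem memLp_weight_rpow {v : 𝔼 → ℝ} (hv : ∀ᵐ x, 0 ≤ v x) {β q : ℝ} (hβ : 1 < β) (hq : 0 < q)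
    (hvβ : LocallyIntegrable (fun x => v x ^ β) volume) {E : Set 𝔼} {R : ℝ}
    (hER : E ⊆ Metric.ball 0 R) :
    MemLp (fun x => v x ^ (1 / q)) (ENNReal.ofReal (q * β)) (volume.restrict E) := by
  have hi : IntegrableOn (fun x => v x ^ β) E :=
    (hvβ.integrableOn_isCompact (isCompact_closedBall 0 R)).mono_set
      (hER.trans Metric.ball_subset_closedBall)
  have := memLp_rpow_of_integrable_rpow (r := q * β) (by positivity) (ae_restrict_of_ae hv) hi
  rwa [show β / (q * β) = 1 / q by field_simp] at this

/-- `Lˢ` on a ball embeds into `L^q(E, v dx)` if `v^β` is locally integrable and `qβ' ≤ s`. -/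
theorem exists_eLpNorm_weighted_le {v : 𝔼 → ℝ} (hv : ∀ᵐ x, 0 ≤ v x) {β q s : ℝ} (hβ : 1 < β)
    (hq : 0 < q) (hqs : q * (β / (β - 1)) ≤ s)
    (hvβ : LocallyIntegrable (fun x => v x ^ β) volume) {E : Set 𝔼} {R : ℝ}
    (hER : E ⊆ Metric.ball 0 R) :
    ∃ C : ℝ≥0∞, C ≠ ⊤ ∧ ∀ f : 𝔼 → ℝ,
      AEStronglyMeasurable f (volume.restrict (Metric.ball 0 R)) →
      eLpNorm f (ENNReal.ofReal q) ((weightedMeasure v).restrict E) ≤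
        C * eLpNorm f (ENNReal.ofReal s) (volume.restrict (Metric.ball 0 R)) := by
  have hβ1 : 0 < β - 1 := by linarith
  have hpos : 0 < q * (β / (β - 1)) := by positivity
  have hmem := memLp_weight_rpow hv hβ hq hvβ hER
  have hvm := aestronglyMeasurable_of_rpow (by linarith) hv hvβ.aestronglyMeasurable
  refine ⟨eLpNorm (fun x => v x ^ (1 / q)) (ENNReal.ofReal (q * β)) (volume.restrict E) *
    volume (Metric.ball (0 : 𝔼) R) ^ (1 / (q * (β / (β - 1))) - 1 / s),
    ENNReal.mul_ne_top hmem.2.ne (ENNReal.rpow_ne_top_of_nonneg ?_ measure_ball_lt_top.ne),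
    fun f hf => ?_⟩
  · rw [sub_nonneg]
    exact one_div_le_one_div_of_le hpos hqs
  · rw [eLpNorm_weightedMeasure_restrict hvm hv hq]
    refine (eLpNorm_smul_ofReal_le hβ hq hqs hER hmem.1 hf).trans_eq (by ring)

/-- Almost everywhere convergence of a sequence which is bounded in `Lˢ` on a ball implies
convergence in `L^q(E, v dx)` if `v^β` is locally integrable and `qβ' ≤ s`. -/
theorem tendsto_eLpNorm_weighted_of_ae_tendsto {v : 𝔼 → ℝ} (hv : ∀ᵐ x, 0 ≤ v x) {β q s : ℝ}
    (hβ : 1 < β) (hq : 1 ≤ q) (hqs : q * (β / (β - 1)) ≤ s)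
    (hvβ : LocallyIntegrable (fun x => v x ^ β) volume) {E : Set 𝔼} {R : ℝ}
    (hER : E ⊆ Metric.ball 0 R) {u : ℕ → 𝔼 → ℝ} {f : 𝔼 → ℝ}
    (hu : ∀ k, AEStronglyMeasurable (u k) (volume.restrict (Metric.ball 0 R))) {M : ℝ≥0∞}
    (hM : M ≠ ⊤)
    (hb : ∀ k, eLpNorm (u k) (ENNReal.ofReal s) (volume.restrict (Metric.ball 0 R)) ≤ M)
    (hf : ∀ᵐ x ∂(volume.restrict (Metric.ball 0 R)), Tendsto (fun k => u k x) atTop (𝓝 (f x))) :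
    MemLp f (ENNReal.ofReal q) ((weightedMeasure v).restrict E) ∧
      Tendsto (fun k => eLpNorm (u k - f) (ENNReal.ofReal q) ((weightedMeasure v).restrict E))
        atTop (𝓝 0) := by
  have hq0 : 0 < q := by linarith
  have hβ1 : 0 < β - 1 := by linarith
  have hpos : 0 < q * (β / (β - 1)) := by positivity
  have hvm := aestronglyMeasurable_of_rpow (by linarith) hv hvβ.aestronglyMeasurable
  have hmem := memLp_weight_rpow hv hβ hq0 hvβ hER
  have hfm := aestronglyMeasurable_of_tendsto_ae atTop hu hf
  have hfM : eLpNorm f (ENNReal.ofReal s) (volume.restrict (Metric.ball 0 R)) ≤ M := by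
    refine (Lp.eLpNorm_lim_le_liminf_eLpNorm hu f hf).trans ?_
    exact liminf_le_of_le (by isBoundedDefault) fun b hb' => by
      obtain ⟨k, hk⟩ := hb'.exists
      exact hk.trans (hb k)
  obtain ⟨C, hC, hCf⟩ := exists_eLpNorm_weighted_le hv hβ hq0 hqs hvβ hER
  have hac : (weightedMeasure v).restrict E ≪ volume.restrict (Metric.ball 0 R) :=
    ((weightedMeasure_absolutelyContinuous v).restrict E).trans
      (Measure.restrict_mono_set _ hER).absolutelyContinuous
  have hmemf : MemLp f (ENNReal.ofReal q) ((weightedMeasure v).restrict E) :=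
    ⟨hfm.mono_ac hac, (hCf f hfm).trans_lt
      (ENNReal.mul_lt_top hC.lt_top (hfM.trans_lt hM.lt_top))⟩
  refine ⟨hmemf, ?_⟩
  have : IsFiniteMeasure (volume.restrict E) :=
    ⟨by rw [Measure.restrict_apply_univ]; exact (measure_mono hER).trans_lt measure_ball_lt_top⟩
  have hle := Measure.restrict_mono_set (volume : Measure 𝔼) hER
  set φ : 𝔼 → ℝ := fun x => v x ^ (1 / q)
  set b := volume (Metric.ball (0 : 𝔼) R) ^ (1 / (q * (β / (β - 1))) - 1 / s)
  have hbt : b ≠ ⊤ := ENNReal.rpow_ne_top_of_nonneg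
    (sub_nonneg.2 (one_div_le_one_div_of_le hpos hqs)) measure_ball_lt_top.ne
  have hlim := tendsto_Lp_finite_of_tendsto_ae (μ := volume.restrict E) (p := ENNReal.ofReal q)
    (by simpa using hq) ENNReal.ofReal_ne_top (f := fun k => φ • u k) (g := φ • f)
    (fun k => hmem.1.smul ((hu k).mono_measure hle))
    ⟨hmem.1.smul (hfm.mono_measure hle), by
      rw [← eLpNorm_weightedMeasure_restrict hvm hv hq0]; exact hmemf.2⟩ ?_ ?_
  · refine hlim.congr fun k => ?_
    rw [eLpNorm_weightedMeasure_restrict hvm hv hq0, smul_sub]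
  · intro ε hε
    have hMb : M * b ≠ ⊤ := ENNReal.mul_ne_top hM hbt
    set m := (M * b).toReal
    have hm : 0 ≤ m := ENNReal.toReal_nonneg
    -- Absolute continuity of the norm of the single function `v^{1/q}` gives a `δ` independent of
    -- `k`; the `u k` contribute only the bound `m`. The `+ 1` avoids division by zero.
    obtain ⟨δ, hδ, hδφ⟩ := hmem.eLpNorm_indicator_le (ε := ε / (m + 1))
      (ENNReal.one_le_ofReal.2 (by nlinarith)) ENNReal.ofReal_ne_top (by positivity)
    refine ⟨δ, hδ, fun k t ht htδ => ?_⟩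
    have hind : t.indicator (φ • u k) = t.indicator φ • u k := by
      ext x; by_cases hx : x ∈ t <;> simp [hx]
    rw [hind]
    refine (eLpNorm_smul_ofReal_le hβ hq0 hqs hER (hmem.1.indicator ht) (hu k)).trans ?_
    calc _ ≤ ENNReal.ofReal (ε / (m + 1)) * (M * b) :=
          mul_le_mul' (hδφ t ht htδ) (mul_le_mul_left (hb k) _)
      _ = ENNReal.ofReal (ε / (m + 1) * m) := by
          rw [ENNReal.ofReal_mul (by positivity), ENNReal.ofReal_toReal hMb]
      _ ≤ ENNReal.ofReal ε := by
          refine ENNReal.ofReal_le_ofReal ?_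
          rw [div_mul_eq_mul_div, div_le_iff₀ (by positivity)]
          nlinarith
  · filter_upwards [ae_mono hle hf] with x hx
    exact hx.const_smul (φ x)

end Weight

/-! ### Poincaré–Sobolev inequalities and control of the constant -/

section PoincareSobolev
variable {n : ℕ}
local notation "𝔼" => EuclideanSpace ℝ (Fin n)

/-- Partial derivatives of test functions have integral zero. -/
theorem HasWeakGradient.sub_const {u : 𝔼 → ℝ} {g : 𝔼 → 𝔼} (h : HasWeakGradient u g) (c : ℝ) :
    HasWeakGradient (fun x => u x - c) g := by
  refine ⟨h.1.sub (locallyIntegrable_const c), h.2.1, fun φ hφ hφc i => ?_⟩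
  have hφ1 : ContDiff ℝ 1 φ := hφ.of_le (by exact_mod_cast le_top)
  have hc : Continuous fun x => fderiv ℝ φ x (EuclideanSpace.single i 1) :=
    (hφ1.continuous_fderiv one_ne_zero).clm_apply continuous_const
  have hcs : HasCompactSupport fun x => fderiv ℝ φ x (EuclideanSpace.single i 1) :=
    (hφc.fderiv ℝ).comp_left (g := fun L : 𝔼 →L[ℝ] ℝ => L (EuclideanSpace.single i 1)) rfl
  have h0 : ∫ x, c * fderiv ℝ φ x (EuclideanSpace.single i 1) = 0 := by
    rw [integral_mul_fderiv_eq_neg_fderiv_mul_of_integrable (f := fun _ => c)]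
    · simp
    · simp
    · exact (hc.integrable_of_hasCompactSupport hcs).const_mul c
    · exact (hφ1.continuous.integrable_of_hasCompactSupport hφc).const_mul c
    · exact fun x _ => differentiableAt_const c
    · exact fun x _ => hφ1.differentiable one_ne_zero x
  simp_rw [sub_mul]
  rw [integral_sub _ ((hc.integrable_of_hasCompactSupport hcs).const_mul c), h0, sub_zero,
    h.2.2 φ hφ hφc i]
  exact h.1.integrable_smul_right_of_hasCompactSupport hc hcs

/-- The Sobolev inequality is applied to `u - c`, with `c` from Poincaré on the enlarged ball of
radius `R + 3`, which absorbs the zeroth-order term. -/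
theorem exists_poincare_sobolev (hn : 0 < n) {s s' : ℝ≥0} (hs : 1 ≤ s) (hs'0 : s' ≠ 0)
    (hs' : (s' : ℝ)⁻¹ = (s : ℝ)⁻¹ - (n : ℝ)⁻¹) {R : ℝ} (hR : 0 < R) :
    ∃ C : ℝ≥0∞, C ≠ ⊤ ∧ ∀ (u : 𝔼 → ℝ) (g : 𝔼 → 𝔼), HasWeakGradient u g → ∃ c : ℝ,
      eLpNorm (fun x => u x - c) s' (volume.restrict (Metric.ball 0 R)) ≤
        C * eLpNorm g s (volume.restrict (Metric.ball 0 (3 * (R + 3) + 1))) := by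
  obtain ⟨C, hC, hCu⟩ := exists_sobolev hn hs hs'0 hs' hR
  obtain ⟨D, hD, hDu⟩ := exists_poincare (n := n) (s := s) (by exact_mod_cast hs)
    (R := R + 3) (by linarith)
  have hs0 : s ≠ 0 := (zero_lt_one.trans_le hs).ne'
  refine ⟨C * (D ^ (1 / (s : ℝ)) + 1), ENNReal.mul_ne_top hC (ENNReal.add_ne_top.2
    ⟨ENNReal.rpow_ne_top_of_nonneg (by positivity) hD, ENNReal.one_ne_top⟩), fun u g h => ?_⟩
  obtain ⟨c, hc⟩ := hDu u g h
  refine ⟨c, (hCu _ g (h.sub_const c)).trans ?_⟩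
  rw [mul_assoc, add_mul, one_mul]
  refine mul_le_mul_right (add_le_add ?_ (eLpNorm_mono_measure _
    (Measure.restrict_mono_set _ (Metric.ball_subset_ball (by linarith))))) _
  rw [eLpNorm_nnreal_eq_lintegral hs0, eLpNorm_nnreal_eq_lintegral hs0,
    ← ENNReal.mul_rpow_of_nonneg _ _ (by positivity)]
  exact ENNReal.rpow_le_rpow hc (by positivity)

/-- In the Poincaré–Sobolev inequality, the constant can be controlled by the norm of `u` in
`L¹(ρ)` for any finite measure `ρ ≠ 0` such that `L^{s'}` on the ball embeds into `L¹(ρ)`. -/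
theorem exists_sobolev_of_measure (hn : 0 < n) {s s' : ℝ≥0} (hs : 1 ≤ s) (hs'0 : s' ≠ 0)
    (hs' : (s' : ℝ)⁻¹ = (s : ℝ)⁻¹ - (n : ℝ)⁻¹) {R : ℝ} (hR : 0 < R) {ρ : Measure 𝔼} (hρ : ρ ≠ 0)
    (hρac : ρ ≪ volume) {D : ℝ≥0∞} (hD : D ≠ ⊤)
    (hDf : ∀ f : 𝔼 → ℝ, AEStronglyMeasurable f (volume.restrict (Metric.ball 0 R)) →
      eLpNorm f 1 ρ ≤ D * eLpNorm f s' (volume.restrict (Metric.ball 0 R))) :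
    ∃ C : ℝ≥0∞, C ≠ ⊤ ∧ ∀ (u : 𝔼 → ℝ) (g : 𝔼 → 𝔼), HasWeakGradient u g →
      eLpNorm u s' (volume.restrict (Metric.ball 0 R)) ≤
        C * (eLpNorm g s (volume.restrict (Metric.ball 0 (3 * (R + 3) + 1))) +
          eLpNorm u 1 ρ) := by
  obtain ⟨C, hC, hCu⟩ := exists_poincare_sobolev hn hs hs'0 hs' hR
  set μ := volume.restrict (Metric.ball (0 : 𝔼) R)
  set m := ρ Set.univ
  have hm0 : m ≠ 0 := by simpa [m] using hρ
  set b := eLpNorm (fun _ : 𝔼 => (1 : ℝ)) s' μ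
  have hs'1 : (s' : ℝ≥0∞) ≠ 0 := by exact_mod_cast hs'0
  have hb : b ≠ ⊤ := by
    refine ((eLpNorm_const_lt_top_iff hs'1 ENNReal.coe_ne_top).2 (Or.inr ?_)).ne
    rw [Measure.restrict_apply_univ]
    exact measure_ball_lt_top
  -- Finiteness of `ρ` comes from testing the embedding on the constant `1`.
  have hm : m ≠ ⊤ := by
    have := hDf (fun _ => 1) aestronglyMeasurable_const
    rw [eLpNorm_one_eq_lintegral_enorm] at this
    simp only [enorm_one, lintegral_const, one_mul] at this
    exact (this.trans_lt (ENNReal.mul_lt_top hD.lt_top hb.lt_top)).ne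
  have hs'1' : (1 : ℝ≥0∞) ≤ s' := by
    have hs0 : (0 : ℝ) < s := by positivity
    have hn0 : (0 : ℝ) ≤ (n : ℝ)⁻¹ := by positivity
    have h1 : (s' : ℝ)⁻¹ ≤ 1 := by
      rw [hs']
      linarith [inv_le_one_of_one_le₀ (show (1 : ℝ) ≤ s by exact_mod_cast hs)]
    have h2 : (0 : ℝ) < s' := by positivity
    exact_mod_cast (inv_le_one₀ h2).1 h1
  refine ⟨C + (D * C + 1) / m * b, ENNReal.add_ne_top.2 ⟨hC, ENNReal.mul_ne_top
    (ENNReal.div_ne_top (ENNReal.add_ne_top.2 ⟨ENNReal.mul_ne_top hD hC, ENNReal.one_ne_top⟩) hm0)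
    hb⟩, fun u g h => ?_⟩
  obtain ⟨c, hc⟩ := hCu u g h
  set G := eLpNorm g s (volume.restrict (Metric.ball 0 (3 * (R + 3) + 1)))
  set U := eLpNorm u 1 ρ
  have hum := h.1.aestronglyMeasurable
  have hucm : AEStronglyMeasurable (fun x => u x - c) volume := hum.sub aestronglyMeasurable_const
  -- The constant is `u - (u - c)`: the first term is measured directly in `L¹(ρ)`, the second
  -- through the embedding and Poincaré–Sobolev.
  have hcm : ‖c‖ₑ * m ≤ (D * C + 1) * (G + U) := by
    calc ‖c‖ₑ * m = eLpNorm (fun _ : 𝔼 => c) 1 ρ := by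
          rw [eLpNorm_one_eq_lintegral_enorm, lintegral_const]
      _ = eLpNorm (u - fun x => u x - c) 1 ρ := by congr 1; ext x; simp
      _ ≤ eLpNorm u 1 ρ + eLpNorm (fun x => u x - c) 1 ρ :=
          eLpNorm_sub_le (hum.mono_ac hρac) (hucm.mono_ac hρac) le_rfl
      _ ≤ U + D * (C * G) := by
          gcongr
          exact (hDf _ hucm.restrict).trans (mul_le_mul_right hc _)
      _ ≤ U + D * (C * G) + (D * C * U + G) := le_self_add
      _ = (D * C + 1) * (G + U) := by ring
  have hce : ‖c‖ₑ ≤ (D * C + 1) / m * (G + U) := by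
    rw [← ENNReal.mul_div_right_comm]
    exact (ENNReal.le_div_iff_mul_le (Or.inl hm0) (Or.inl hm)).2 hcm
  calc eLpNorm u s' μ = eLpNorm ((fun x => u x - c) + c • fun _ => (1 : ℝ)) s' μ := by
        congr 1; ext x; simp
    _ ≤ eLpNorm (fun x => u x - c) s' μ + eLpNorm (c • fun _ : 𝔼 => (1 : ℝ)) s' μ :=
        eLpNorm_add_le hucm.restrict (aestronglyMeasurable_const.const_smul c) hs'1'
    _ ≤ C * G + (D * C + 1) / m * (G + U) * b := by
        rw [eLpNorm_const_smul]
        gcongr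
    _ ≤ C * G + (D * C + 1) / m * (G + U) * b + C * U := le_self_add
    _ = _ := by ring

end PoincareSobolev

/-! ### Compactness from local bounds -/

section Compact
variable {n : ℕ}
local notation "𝔼" => EuclideanSpace ℝ (Fin n)

theorem hasWeakGradient_weakGradient {u : 𝔼 → ℝ} (h : ∃ g, HasWeakGradient u g) :
    HasWeakGradient u (weakGradient u) := by
  rw [weakGradient, dif_pos h]
  exact h.choose_spec

theorem lintegral_ball_le_of_eLpNorm_le {F : Type*} [NormedAddCommGroup F] {f : 𝔼 → F}
    (hf : AEStronglyMeasurable f volume) {s : ℝ} (hs : 1 ≤ s) {r R : ℝ} (hr : r ≤ R) {M : ℝ≥0∞}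
    (hM : eLpNorm f (ENNReal.ofReal s) (volume.restrict (Metric.ball 0 R)) ≤ M) :
    ∫⁻ x in Metric.ball 0 r, ‖f x‖ₑ ≤ M * volume (Metric.ball (0 : 𝔼) R) ^ (1 - 1 / s) := by
  refine (lintegral_mono_set (Metric.ball_subset_ball hr)).trans ?_
  rw [← eLpNorm_one_eq_lintegral_enorm]
  have := eLpNorm_le_eLpNorm_mul_rpow_measure_univ (ENNReal.one_le_ofReal.2 hs)
    (hf.restrict (s := Metric.ball 0 R))
  rw [Measure.restrict_apply_univ, ENNReal.toReal_one, div_one,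
    ENNReal.toReal_ofReal (by linarith)] at this
  exact this.trans (mul_le_mul_left hM _)

theorem isCompactEmbedding_of_measure_eq_zero {μ ν : Measure 𝔼} {E : Set 𝔼}
    (h : ν.restrict E = 0) (Y : Set (𝔼 → ℝ)) (N : (𝔼 → ℝ) → ℝ≥0∞) (q : ℝ) :
    IsCompactEmbedding μ Y N q E ν := by
  rw [IsCompactEmbedding, h]
  exact ⟨fun u _ => by simp, fun u _ u' _ _ => by simp [Filter.EventuallyEq],
    fun u _ _ => ⟨0, by simp, id, strictMono_id, by simp⟩⟩

/-- The common core of both embeddings: once `u` and its gradient are bounded by the norm on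
slightly larger balls, Rellich and the Vitali argument apply. The radii `R + 1` and `R + 2` are
those that Rellich's theorem on the ball of radius `R` requires. Independence of the representative
holds because `w > 0` makes `w dx`-null sets Lebesgue null. -/
theorem isCompactEmbedding_of_bounds {w v : 𝔼 → ℝ} (hwm : AEStronglyMeasurable w volume)
    (hw : ∀ᵐ x, 0 < w x) (hv : ∀ᵐ x, 0 ≤ v x) {β q s s' : ℝ} (hβ : 1 < β) (hq : 1 ≤ q)
    (hs : 1 ≤ s) (hs' : 1 ≤ s') (hqs : q * (β / (β - 1)) ≤ s')
    (hvβ : LocallyIntegrable (fun x => v x ^ β) volume) {E : Set 𝔼} {R : ℝ}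
    (hER : E ⊆ Metric.ball 0 R) {Y : Set (𝔼 → ℝ)} {N : (𝔼 → ℝ) → ℝ≥0∞}
    (hY : ∀ u ∈ Y, ∃ g, HasWeakGradient u g) (hN : ∀ u ∈ Y, N u < ⊤) {C : ℝ≥0∞} (hC : C ≠ ⊤)
    (hu : ∀ u ∈ Y, eLpNorm u (ENNReal.ofReal s') (volume.restrict (Metric.ball 0 (R + 1))) ≤
      C * N u)
    (hg : ∀ u ∈ Y, eLpNorm (weakGradient u) (ENNReal.ofReal s)
      (volume.restrict (Metric.ball 0 (R + 2))) ≤ C * N u) :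
    IsCompactEmbedding (weightedMeasure w) Y N q E (weightedMeasure v) := by
  have hac : (weightedMeasure v).restrict E ≪ volume :=
    Measure.restrict_le_self.absolutelyContinuous.trans (weightedMeasure_absolutelyContinuous v)
  have hwg : ∀ u ∈ Y, HasWeakGradient u (weakGradient u) :=
    fun u hu => hasWeakGradient_weakGradient (hY u hu)
  have hRR : Metric.ball (0 : 𝔼) R ⊆ Metric.ball 0 (R + 1) := Metric.ball_subset_ball (by linarith)
  refine ⟨fun u huY => ?_, fun u _ u' _ h => ?_, fun u huY ⟨M, hM⟩ => ?_⟩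
  · obtain ⟨D, hD, hDf⟩ := exists_eLpNorm_weighted_le hv hβ (by linarith) hqs hvβ (hER.trans hRR)
    have hum := (hwg u huY).1.aestronglyMeasurable
    exact ⟨hum.mono_ac hac, (hDf u hum.restrict).trans_lt (ENNReal.mul_lt_top hD.lt_top
      ((hu u huY).trans_lt (ENNReal.mul_lt_top hC.lt_top (hN u huY))))⟩
  · exact hac.ae_le ((absolutelyContinuous_weightedMeasure hwm hw).ae_le h)
  · have hCM : C * M ≠ ⊤ := ENNReal.mul_ne_top hC ENNReal.coe_ne_top
    have hub : ∀ k, eLpNorm (u k) (ENNReal.ofReal s')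
        (volume.restrict (Metric.ball 0 (R + 1))) ≤ C * M :=
      fun k => (hu _ (huY k)).trans (mul_le_mul_right (hM k) _)
    have hgb : ∀ k, eLpNorm (weakGradient (u k)) (ENNReal.ofReal s)
        (volume.restrict (Metric.ball 0 (R + 2))) ≤ C * M :=
      fun k => (hg _ (huY k)).trans (mul_le_mul_right (hM k) _)
    have hfin : ∀ t r : ℝ, 1 ≤ t → C * M * volume (Metric.ball (0 : 𝔼) r) ^ (1 - 1 / t) ≠ ⊤ := by
      intro t r ht
      refine ENNReal.mul_ne_top hCM (ENNReal.rpow_ne_top_of_nonneg ?_ measure_ball_lt_top.ne)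
      rw [sub_nonneg, div_le_one (by linarith)]
      exact ht
    set a := C * M * volume (Metric.ball (0 : 𝔼) (R + 1)) ^ (1 - 1 / s')
    set b := C * M * volume (Metric.ball (0 : 𝔼) (R + 2)) ^ (1 - 1 / s)
    have hab : a + b ≠ ⊤ := ENNReal.add_ne_top.2 ⟨hfin _ _ hs', hfin _ _ hs⟩
    obtain ⟨f, σ, hσ, hlim⟩ := exists_strictMono_ae_tendsto (fun k => hwg _ (huY k)) R
      (M := (a + b).toNNReal)
      (fun k => by
        rw [ENNReal.coe_toNNReal hab]
        exact (lintegral_ball_le_of_eLpNorm_le (hwg _ (huY k)).1.aestronglyMeasurable hs' le_rfl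
          (hub k)).trans le_self_add)
      (fun k => by
        rw [ENNReal.coe_toNNReal hab]
        exact (lintegral_ball_le_of_eLpNorm_le (hwg _ (huY k)).2.1.aestronglyMeasurable hs le_rfl
          (hgb k)).trans le_add_self)
    obtain ⟨hf, ht⟩ := tendsto_eLpNorm_weighted_of_ae_tendsto hv hβ hq hqs hvβ hER
      (u := fun k => u (σ k)) (fun k => (hwg _ (huY _)).1.aestronglyMeasurable.restrict) hCM
      (fun k => (eLpNorm_mono_measure _ (Measure.restrict_mono_set _ hRR)).trans (hub _)) hlim
    exact ⟨f, hf, σ, hσ, ht⟩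

end Compact

end WeightedSobolev

end

/-! ### The main theorem -/

open WeightedSobolev in
theorem mainTheorem7 (n : ℕ) (w v : EuclideanSpace ℝ (Fin n) → ℝ) (α β p : ℝ)
    (hα : 0 < α) (hβ : 1 < β)
    (hw_pos : ∀ᵐ x, 0 < w x) (hv_nonneg : ∀ᵐ x, 0 ≤ v x)
    (hw : LocallyIntegrable w volume)
    (hwα : LocallyIntegrable (fun x => w x ^ (-α)) volume)
    (hvβ : LocallyIntegrable (fun x => v x ^ β) volume)
    (hp_lower : max ((n : ℝ) * (1 / α + 1 / β)) (1 + 1 / α) ≤ p)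
    (hp_upper : p < (n : ℝ) * (1 + 1 / α))
    (E : Set (EuclideanSpace ℝ (Fin n)))
    (hE_bdd : Bornology.IsBounded E) (hE_meas : NullMeasurableSet E volume)
    (q : ℝ) (hq_one : 1 ≤ q)
    (hq : q ≤ (n : ℝ) * p * (1 - 1 / β) / (((n : ℝ) - p) + (n : ℝ) / α)) :
    WeightedSobolev.IsCompactEmbedding (WeightedSobolev.weightedMeasure w)
        (WeightedSobolev.sobolevSpace p (WeightedSobolev.weightedMeasure w))
        (WeightedSobolev.sobolevNorm p (WeightedSobolev.weightedMeasure w))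
        q E (WeightedSobolev.weightedMeasure v) ∧
      WeightedSobolev.IsCompactEmbedding (WeightedSobolev.weightedMeasure w)
        (WeightedSobolev.dirichletSpace p (WeightedSobolev.weightedMeasure w) ∩
          WeightedSobolev.integrableOnSpace E (WeightedSobolev.weightedMeasure v))
        (WeightedSobolev.dirichletNorm p (WeightedSobolev.weightedMeasure w) E
          (WeightedSobolev.weightedMeasure v))
        q E (WeightedSobolev.weightedMeasure v) := by
  have hp1 : 1 + 1 / α ≤ p := (le_max_right _ _).trans hp_lower
  have hα1 : 0 < 1 / α := by positivity
  have hp0 : 0 < p := by linarith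
  -- In dimension zero the upper bound would force `p < 0`.
  have hn : 0 < n := by
    rcases Nat.eq_zero_or_pos n with rfl | h
    · simp at hp_upper; linarith
    · exact h
  have hn' : (0 : ℝ) < n := by exact_mod_cast hn
  set d : ℝ := ((n : ℝ) - p) + (n : ℝ) / α with hd_def
  have hd : 0 < d := by
    have : (n : ℝ) * (1 + 1 / α) = n + n / α := by ring
    rw [hd_def]; linarith
  -- `s` is the unweighted gradient exponent given by Hölder, and `s'` below is its Sobolev
  -- conjugate.
  set s : ℝ := α * p / (α + 1) with hs_def
  set s' : ℝ := n * p / d with hs'_def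
  have hs'0 : 0 < s' := by positivity
  have hs0 : 0 < s := by positivity
  have hs1 : 1 ≤ s := by
    rw [hs_def, le_div_iff₀ (by positivity)]
    have := mul_le_mul_of_nonneg_left hp1 hα.le
    rw [mul_add, mul_one_div_cancel hα.ne'] at this
    linarith
  have hss' : s'⁻¹ = s⁻¹ - (n : ℝ)⁻¹ := by
    rw [hs'_def, hs_def, hd_def]
    field_simp
    ring
  have hβ1 : 0 < β - 1 := by linarith
  -- The limiting `q` is precisely `s'` divided by the conjugate exponent of `β`.
  have hqs : q * (β / (β - 1)) ≤ s' := by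
    have : s' = (n : ℝ) * p * (1 - 1 / β) / d * (β / (β - 1)) := by
      rw [hs'_def]; field_simp
    rw [this]
    gcongr
  have hβq : 1 * (β / (β - 1)) ≤ q * (β / (β - 1)) := by gcongr
  have hs'1 : 1 ≤ s' := by
    have : 1 ≤ β / (β - 1) := by rw [le_div_iff₀ hβ1]; linarith
    linarith
  have hsN : 1 ≤ s.toNNReal := by simpa using hs1
  have hsN' : s'.toNNReal ≠ 0 := by simpa using hs'0
  have hssN : (s'.toNNReal : ℝ)⁻¹ = (s.toNNReal : ℝ)⁻¹ - (n : ℝ)⁻¹ := by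
    rwa [Real.coe_toNNReal _ hs'0.le, Real.coe_toNNReal _ hs0.le]
  have hwm := hw.aestronglyMeasurable
  obtain ⟨R₀, hR₀⟩ := hE_bdd.subset_ball 0
  set R := max R₀ 1
  have hR : 0 < R + 1 := by linarith [le_max_right R₀ 1]
  have hER : E ⊆ Metric.ball 0 R := hR₀.trans (Metric.ball_subset_ball (le_max_left _ _))
  -- This is the largest ball needed, the one in Poincaré–Sobolev for radius `R + 1`; all smaller
  -- ones follow by monotonicity.
  obtain ⟨A, hA, hAf⟩ := exists_eLpNorm_ball_le_weighted hwm hw_pos hα hp0 hwα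
    (3 * (R + 1 + 3) + 1)
  have hgA : ∀ u : EuclideanSpace ℝ (Fin n) → ℝ, (∃ g, HasWeakGradient u g) → ∀ r,
      r ≤ 3 * (R + 1 + 3) + 1 →
      eLpNorm (weakGradient u) (ENNReal.ofReal s) (volume.restrict (Metric.ball 0 r)) ≤
        A * eLpNorm (weakGradient u) (ENNReal.ofReal p) (weightedMeasure w) := fun u hu r hr =>
    (eLpNorm_mono_measure _ (Measure.restrict_mono_set _ (Metric.ball_subset_ball hr))).trans
      (hAf _ (hasWeakGradient_weakGradient hu).2.1.aestronglyMeasurable)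
  constructor
  · obtain ⟨C, hC, hCu⟩ := exists_sobolev hn hsN hsN' hssN hR
    refine isCompactEmbedding_of_bounds hwm hw_pos hv_nonneg hβ hq_one hs1 hs'1 hqs hvβ hER
      (C := C * A + A) (fun u hu => hu.1) (fun u hu => ENNReal.add_lt_top.2 ⟨hu.2.1.2, hu.2.2.2⟩)
      (ENNReal.add_ne_top.2 ⟨ENNReal.mul_ne_top hC hA, hA⟩) (fun u hu => ?_) (fun u hu => ?_)
    · refine (hCu u _ (hasWeakGradient_weakGradient hu.1)).trans ?_
      calc _ ≤ C * (A * eLpNorm u (ENNReal.ofReal p) (weightedMeasure w) +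
            A * eLpNorm (weakGradient u) (ENNReal.ofReal p) (weightedMeasure w)) := by
            refine mul_le_mul_right (add_le_add ?_ (hgA u hu.1 _ (by linarith))) _
            exact (eLpNorm_mono_measure _ (Measure.restrict_mono_set _
              (Metric.ball_subset_ball (by linarith)))).trans
              (hAf _ (hasWeakGradient_weakGradient hu.1).1.aestronglyMeasurable)
        _ = C * A * sobolevNorm p (weightedMeasure w) u := by rw [sobolevNorm]; ring
        _ ≤ _ := mul_le_mul_left le_self_add _
    · exact (hgA u hu.1 _ (by linarith)).trans (mul_le_mul' le_add_self le_add_self)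
  -- If `ν` vanishes on `E`, the `L¹(E, ν)` norm cannot control constants, but the target space is
  -- then trivial.
  · by_cases hν : (weightedMeasure v).restrict E = 0
    · exact isCompactEmbedding_of_measure_eq_zero hν _ _ _
    -- The embedding is used here with exponent `1`, so that the restriction of `ν` to `E` can play
    -- the role of `ρ`.
    obtain ⟨D, hD, hDf⟩ := exists_eLpNorm_weighted_le hv_nonneg hβ one_pos (hβq.trans hqs) hvβ
      (hER.trans (Metric.ball_subset_ball (by linarith : R ≤ R + 1)))
    rw [ENNReal.ofReal_one] at hDf
    obtain ⟨C, hC, hCu⟩ := exists_sobolev_of_measure hn hsN hsN' hssN hR hν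
      (Measure.restrict_le_self.absolutelyContinuous.trans (weightedMeasure_absolutelyContinuous v))
      hD hDf
    refine isCompactEmbedding_of_bounds hwm hw_pos hv_nonneg hβ hq_one hs1 hs'1 hqs hvβ hER
      (C := C * (A + 1) + A) (fun u hu => hu.1.1)
      (fun u hu => ENNReal.add_lt_top.2 ⟨hu.1.2.2.2, (memLp_one_iff_integrable.2 hu.2).2⟩)
      (ENNReal.add_ne_top.2 ⟨ENNReal.mul_ne_top hC (ENNReal.add_ne_top.2
        ⟨hA, ENNReal.one_ne_top⟩), hA⟩) (fun u hu => ?_) (fun u hu => ?_)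
    · refine (hCu u _ (hasWeakGradient_weakGradient hu.1.1)).trans ?_
      calc _ ≤ C * ((A + 1) * eLpNorm (weakGradient u) (ENNReal.ofReal p) (weightedMeasure w) +
            (A + 1) * eLpNorm u 1 ((weightedMeasure v).restrict E)) := by
            refine mul_le_mul_right (add_le_add ((hgA u hu.1.1 _ le_rfl).trans
              (mul_le_mul_left le_self_add _)) ?_) _
            exact le_mul_of_one_le_left zero_le le_add_self
        _ = C * (A + 1) * dirichletNorm p (weightedMeasure w) E (weightedMeasure v) u := by
            rw [dirichletNorm]; ring
        _ ≤ _ := mul_le_mul_left le_self_add _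
    · exact (hgA u hu.1.1 _ (by linarith)).trans (mul_le_mul' le_add_self le_self_add)
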